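/- \textbf{Conventions.} Let $\Gamma$ be a Bieberbach group, i.e. a discrete, torsion-free, cocompact subgroup of $\mathrm{Isom}(\mathbb R^n)=O(n)\ltimes\mathbb R^n$, and let $M=\mathbb R^n/\Gamma$ be the corresponding closed flat manifold. Let $T\trianglelefteq\Gamma$ be the subgroup of translations, which is free abelian of rank $n$, and let $G=\Gamma/T$ be the (finite) holonomy group. After a choice of free generators $e_1,\dots,e_n$ of $T\cong\mathbb Z^n$, the holonomy representation $\rho\colon G\to\mathrm{GL}(n,\mathbb Z)$ is given by $\rho(g)(e_i)=\tilde g e_i\tilde g^{-1}$, where $\tilde g\in\Gamma$ is any element over $g\in G$. For a continuous map $f\colon M\to M$, a point $x\in M$ and a path from $x$ to $f(x)$, let $f_\sharp$ be the induced endomorphism of $\pi_1(M,x)$. The Reidemeister number $R(f)\in\mathbb N\cup\{\infty\}$ is the number of classes of the equivalence relation $\alpha\sim\gamma\alpha f_\sharp(\gamma)^{-1}$ $(\gamma\in\pi_1(M,x))$ on $\pi_1(M,x)$; it does not depend on the choices. The manifold $M$ has the $R_\infty$ property if $R(f)=\infty$ for every homeomorphism $f\colon M\to M$. \textbf{Theorem.}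 Let $M$ be a flat manifold with holonomy representation $\rho\colon G\to\mathrm{GL}(n,\mathbb Z)$, and suppose that $G$ is solvable. Let $\rho'\colon G\to\mathrm{GL}(n',\mathbb Z)$ be a non-trivial (i.e. $\rho'(G)\neq 1$) $\mathbb Q$-irreducible $\mathbb Q$-subrepresentation of $\rho$ of multiplicity one and of odd dimension $n'$, such that $$N_{\mathrm{GL}(n',\mathbb Q)}(\rho'(G))/C_{\mathrm{GL}(n',\mathbb Q)}(\rho'(G))\cong\mathrm{Aut}(G).$$ If $\rho'$ is faithful, this may be any isomorphism of groups; if $\rho'$ is not faithful, it is understood to be an isomorphism $\Phi$ given by conjugation, i.e. $\rho'(\Phi([x])(g))=x\rho'(g)x^{-1}$ for all $x\in N_{\mathrm{GL}(n',\mathbb Q)}(\rho'(G))$ and $g\in G$. Then $M$ has the $R_\infty$ property. -/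

import Mathlib

noncomputable section

/-! ### Reidemeister numbers and the property `R_∞` -/

/-- Two elements `a`, `b` of a group are `φ`-conjugate if `b = γ a φ(γ)⁻¹` for some `γ`. -/
def twistedConj {Γ : Type*} [Group Γ] (φ : Γ →* Γ) : Setoid Γ where
  r a b := ∃ γ : Γ, b = γ * a * (φ γ)⁻¹
  iseqv :=
    { refl := fun a => ⟨1, by simp⟩
      symm := by
        rintro a b ⟨γ, rfl⟩
        exact ⟨γ⁻¹, by simp [mul_assoc]⟩
      trans := by
        rintro a b c ⟨γ, rfl⟩ ⟨δ, rfl⟩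
        exact ⟨δ * γ, by simp [mul_assoc]⟩ }

/-- The number (possibly `⊤`) of `φ`-conjugacy classes, i.e. of Reidemeister classes of `φ`. -/
def reidemeisterNumber {Γ : Type*} [Group Γ] (φ : Γ →* Γ) : ℕ∞ :=
  ENat.card (Quotient (twistedConj φ))

/-- The endomorphism `f_♯` of `π₁(X, x)` induced by a continuous map `f : X → X`: apply `f`, and
then transport from the base point `f x` back to `x` along a path `p` from `x` to `f x`. -/
def inducedEnd {X : Type*} [TopologicalSpace X] (f : C(X, X)) {x : X} (p : Path x (f x)) :
    FundamentalGroup X x →* FundamentalGroup X x :=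
  (FundamentalGroup.fundamentalGroupMulEquivOfPath p.symm).toMonoidHom.comp
    (FundamentalGroup.map f x)

/-- A (path connected) space `X` has the `R_∞` property if `R(f) = ∞` for every homeomorphism
`f : X → X`. The number `R(f)` does not depend on the base point or on the connecting path;
all choices are quantified over. -/
def HasRInfinity (X : Type*) [TopologicalSpace X] : Prop :=
  ∀ (f : X ≃ₜ X) (x : X) (p : Path x ((f : C(X, X)) x)),
    reidemeisterNumber (inducedEnd (f : C(X, X)) p) = ⊤

/-! ### Bieberbach groups and flat manifolds -/

/-- Euclidean space `ℝⁿ`. -/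
abbrev Euc (n : ℕ) : Type := EuclideanSpace ℝ (Fin n)

/-- The group `Isom(ℝⁿ) = O(n) ⋉ ℝⁿ`. -/
abbrev EucIsom (n : ℕ) : Type := Euc n ≃ᵃⁱ[ℝ] Euc n

/-- `Isom(ℝⁿ)` acts on `ℝⁿ` by evaluation. -/
instance eucIsomMulAction (n : ℕ) : MulAction (EucIsom n) (Euc n) where
  smul g x := g x
  one_smul _ := rfl
  mul_smul _ _ _ := rfl

/-- The usual topology of `O(n) ⋉ ℝⁿ`: an isometry `x ↦ A x + a` is recorded by the pair `(A, a)`,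
with `A` in the normed space of linear operators. -/
instance eucIsomTopology (n : ℕ) : TopologicalSpace (EucIsom n) :=
  TopologicalSpace.induced
    (fun g : EucIsom n =>
      ((g.linearIsometryEquiv.toContinuousLinearEquiv : Euc n →L[ℝ] Euc n), g 0))
    inferInstance

/-- The homomorphism `Isom(ℝⁿ) → O(n)`, `(x ↦ A x + a) ↦ A`. -/
def linearPart (n : ℕ) : EucIsom n →* (Euc n ≃ₗᵢ[ℝ] Euc n) where
  toFun g := g.linearIsometryEquiv
  map_one' := rfl
  map_mul' _ _ := rfl

/-- The translation of `ℝⁿ` by `v`. -/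
def translation {n : ℕ} (v : Euc n) : EucIsom n :=
  AffineIsometryEquiv.constVAdd ℝ (Euc n) v

/-- The orbit space `ℝⁿ/Γ`, with the quotient topology. -/
abbrev FlatOrbitSpace {n : ℕ} (Γ : Subgroup (EucIsom n)) : Type :=
  MulAction.orbitRel.Quotient Γ (Euc n)

/-- `Γ` is a Bieberbach group: a discrete, torsion-free, cocompact subgroup of `Isom(ℝⁿ)`.
The closed flat manifolds of dimension `n` are the orbit spaces `ℝⁿ/Γ` of such groups. -/
structure IsBieberbach {n : ℕ} (Γ : Subgroup (EucIsom n)) : Prop where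
  discrete : DiscreteTopology Γ
  torsionFree : ∀ γ ∈ Γ, IsOfFinOrder γ → γ = 1
  cocompact : CompactSpace (FlatOrbitSpace Γ)

/-- The subgroup of the translations in `Γ`. -/
def translationSubgroup {n : ℕ} (Γ : Subgroup (EucIsom n)) : Subgroup Γ :=
  ((linearPart n).comp Γ.subtype).ker

instance translationSubgroup_normal {n : ℕ} (Γ : Subgroup (EucIsom n)) :
    (translationSubgroup Γ).Normal :=
  MonoidHom.normal_ker _

/-- The holonomy group `G` of `Γ` (and of `ℝⁿ/Γ`). -/
abbrev HolonomyGroup {n : ℕ} (Γ : Subgroup (EucIsom n)) : Type :=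
  Γ ⧸ translationSubgroup Γ

/-- The translations in `Γ`, written additively: the `v ∈ ℝⁿ` such that the translation by `v`
belongs to `Γ`. -/
def translationLattice {n : ℕ} (Γ : Subgroup (EucIsom n)) : AddSubgroup (Euc n) where
  carrier := {v | translation v ∈ Γ}
  zero_mem' := by
    have h : translation (0 : Euc n) = 1 := AffineIsometryEquiv.constVAdd_zero
    simp [h]
  add_mem' := by
    intro a b ha hb
    have h : translation (a + b) = translation a * translation b := by
      ext1 x
      exact add_vadd a b x
    simpa [h] using Γ.mul_mem ha hb
  neg_mem' := by
    intro a ha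
    have h : translation (-a) = (translation a)⁻¹ := by
      rw [eq_inv_iff_mul_eq_one]
      ext1 x
      exact neg_vadd_vadd a x
    simpa [h] using Γ.inv_mem ha

/-- `ρ : G → GL(n, ℤ)` is a holonomy representation of `Γ`: for some choice of free generators
`e₁, …, eₙ` of the group of translations in `Γ`, the matrix `ρ(g)` describes the conjugation
`e_j ↦ γ e_j γ⁻¹` in the basis `e`, where `γ ∈ Γ` is any element over `g ∈ G`. -/
def IsHolonomyRep {n : ℕ} (Γ : Subgroup (EucIsom n)) (ρ : HolonomyGroup Γ →* GL (Fin n) ℤ) :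
    Prop :=
  ∃ e : Module.Basis (Fin n) ℤ (translationLattice Γ), ∀ (γ : Γ) (j : Fin n),
    (γ : EucIsom n) * translation (e j : Euc n) * (γ : EucIsom n)⁻¹ =
      translation ((∑ i, (ρ (QuotientGroup.mk γ)).val i j • e i : translationLattice Γ) : Euc n)

/-! ### Rational representations -/

section Representations

variable {G : Type*} [Group G]

/-- An integral representation, with values in `GL(m, ℚ)`. -/
def ratGL {m : ℕ} (ρ : G →* GL (Fin m) ℤ) : G →* GL (Fin m) ℚ :=
  (Matrix.GeneralLinearGroup.map (Int.castRingHom ℚ)).comp ρ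

/-- An integral representation, as a linear representation on `ℚᵐ`. -/
def ratRep {m : ℕ} (ρ : G →* GL (Fin m) ℤ) : Representation ℚ G (Fin m → ℚ) :=
  (Matrix.toLinAlgEquiv' (R := ℚ) (n := Fin m) : Matrix (Fin m) (Fin m) ℚ →* _).comp
    ((Units.coeHom _).comp (ratGL ρ))

/-- `σ` is (isomorphic to) a subrepresentation of `τ`. -/
def IsSubrep {k V W : Type*} [Field k] [AddCommGroup V] [Module k V] [AddCommGroup W] [Module k W]
    (σ : Representation k G V) (τ : Representation k G W) : Prop :=
  ∃ U : Subrepresentation τ, Nonempty (σ.Equiv U.toRepresentation)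

/-- The multiplicity of `σ` in `τ`: the largest `r` such that the direct sum of `r` copies of `σ`
is a subrepresentation of `τ`. -/
def repMultiplicity {k V W : Type*} [Field k] [AddCommGroup V] [Module k V] [AddCommGroup W]
    [Module k W] (σ : Representation k G V) (τ : Representation k G W) : ℕ :=
  sSup {r : ℕ | IsSubrep (Representation.directSum (fun _ : Fin r => σ)) τ}

/-- `N/C`, where `N` and `C` are the normalizer and the centralizer of `ρ(G)` in `GL(m, ℚ)`. -/
abbrev NormalizerModCentralizer {m : ℕ} (ρ : G →* GL (Fin m) ℤ) : Type :=
  Subgroup.normalizer ((ratGL ρ).range : Set (GL (Fin m) ℚ)) ⧸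
    (Subgroup.centralizer ((ratGL ρ).range : Set (GL (Fin m) ℚ))).subgroupOf
      (Subgroup.normalizer ((ratGL ρ).range : Set (GL (Fin m) ℚ)))

/-- The condition `N/C ≅ Aut(G)` for `ρ : G → GL(m, ℤ)`. If `ρ` is faithful, any isomorphism of
groups will do. If `ρ` is not faithful, the isomorphism has to be the one given by conjugation:
the class of `x ∈ N` goes to an automorphism `α` of `G` with `ρ(α(g)) = x ρ(g) x⁻¹`. -/
def NormalizerRealizesAut {m : ℕ} (ρ : G →* GL (Fin m) ℤ) : Prop :=
  ∃ Φ : NormalizerModCentralizer ρ ≃* MulAut G,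
    Function.Injective ρ ∨
      ∀ (x : Subgroup.normalizer ((ratGL ρ).range : Set (GL (Fin m) ℚ))) (g : G),
        ratGL ρ (Φ (QuotientGroup.mk x) g) =
          (x : GL (Fin m) ℚ) * ratGL ρ g * (x : GL (Fin m) ℚ)⁻¹

end Representations

end

noncomputable section

open Module
open scoped commutatorElement

/-! A homeomorphism of the flat manifold induces an automorphism `φ` of `Γ`. It preserves the
translations `T`, acts on them by an integral matrix `M`, and induces an automorphism `α` of the
holonomy group with `M ρ(g) = ρ(α g) M`. If some `ρ(g) M` has eigenvalue `1`, it also has a nonzero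
integral left fixed vector, that is, a nonzero homomorphism `T → ℤ` invariant under `φ` followed by
conjugation by a lift of `g`. Since `T` has finite index, this forces infinitely many Reidemeister
classes (`reidemeisterNumber_eq_top`).

To find `g`, note that the normalizer condition makes `ρ' ∘ α` conjugate to `ρ'` over `ℚ`
(`NormalizerRealizesAut.exists_conj`). Hence `M` carries the copy `W` of `ρ'` in `ℚⁿ` to another
copy of `ρ'`, and multiplicity one forces `M W = W` (`range_eq_of_repMultiplicity_eq_one`). What
remains is a statement about a finite solvable irreducible nontrivial group `S` in odd dimension and
a lattice-preserving `F` normalizing it: some element of `S F` fixes a nonzero vector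
(`exists_fixed_vector`).

This is proved by induction on the dimension. If `S ⊆ {±1}`, the space is a line, the lattice forces
`F = ±1`, and `-1 ∈ S` corrects the sign. Otherwise `S` has an abelian subgroup `A`, not contained
in `{±1}`, that is stable under everything normalizing `S`
(`exists_commutative_subgroup_not_isSignScalar`). Odd dimension gives `A` a common eigenvector with
eigenvalues `±1`. The corresponding eigenspaces are permuted by `S` and `F`, and transitively by
`S`, so their common dimension divides an odd number. After correction by an element of `S`, `F`
stabilizes one of them, and the induction hypothesis applies there. -/

/-! ### Reidemeister numbers and invariant homomorphisms to `ℤ` -/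

theorem reidemeisterNumber_congr {Γ Δ : Type*} [Group Γ] [Group Δ] (e : Γ ≃* Δ) (φ : Γ →* Γ)
    (ψ : Δ →* Δ) (h : ∀ g, e (φ g) = ψ (e g)) : reidemeisterNumber φ = reidemeisterNumber ψ := by
  refine ENat.card_congr (Quotient.congr e.toEquiv ?_)
  intro a b
  constructor
  · rintro ⟨γ, rfl⟩
    exact ⟨e γ, by simp [h]⟩
  · rintro ⟨γ, hγ⟩
    refine ⟨e.symm γ, e.injective ?_⟩
    have hb : e b = γ * e a * (ψ γ)⁻¹ := hγ
    simp [h, hb]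

/-- If a finite index subgroup `T` carries a non-zero homomorphism to `ℤ` which is invariant under
the endomorphism `φ` followed by an inner automorphism, then `R(φ) = ∞`. -/
theorem reidemeisterNumber_eq_top {Γ : Type*} [Group Γ] (T : Subgroup Γ) [T.Normal]
    [Finite (Γ ⧸ T)] (φ : Γ →* Γ) (γ₀ : Γ) (hT : ∀ t ∈ T, φ t ∈ T)
    (l : T →* Multiplicative ℤ) (hl : l ≠ 1)
    (hinv : ∀ t u : T, (u : Γ) = γ₀ * φ t * γ₀⁻¹ → l u = l t) :
    reidemeisterNumber φ = ⊤ := by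
  rw [reidemeisterNumber, ENat.card_eq_top]
  by_contra hfin
  rw [not_infinite_iff_finite] at hfin
  have hrange : (Set.range l).Infinite := by
    obtain ⟨t, ht⟩ : ∃ t, l t ≠ 1 := by
      by_contra! h
      exact hl (MonoidHom.ext h)
    refine Set.infinite_of_injective_forall_mem (f := fun k : ℤ => l (t ^ k)) ?_
      (fun k => ⟨_, rfl⟩)
    intro a b hab
    simp only [map_zpow] at hab
    have h1 : (l t).toAdd ≠ 0 := by simpa using ht
    have h2 := congrArg Multiplicative.toAdd hab
    simp only [toAdd_zpow, smul_eq_mul] at h2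
    exact mul_right_cancel₀ h1 h2
  -- The twisted classes are tested on the coset `T γ₀`. Finitely many classes would cover the
  -- infinite range of `l`, so it suffices that `l` takes finitely many values on each class.
  let cls : T → Quotient (twistedConj φ) := fun t => Quotient.mk _ ((t : Γ) * γ₀)
  have hcover : Set.range l = ⋃ q, l '' (cls ⁻¹' {q}) := by
    rw [← Set.image_iUnion, ← Set.preimage_iUnion, Set.iUnion_of_singleton, Set.preimage_univ,
      Set.image_univ]
  refine hrange (hcover ▸ Set.finite_iUnion fun q => ?_)
  rcases Set.eq_empty_or_nonempty (cls ⁻¹' {q}) with he | ⟨t, ht⟩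
  · simp [he]
  classical
  -- If `δ` conjugates `t γ₀` to `t' γ₀` and `δ = τ * s.out` with `τ ∈ T`, invariance of `l` cancels
  -- the contribution of `τ`. So `l t' = l (u s)` depends only on the coset `s`. The value `1` below
  -- is a dummy for those `s` with `u s ∉ T`.
  let u : Γ ⧸ T → Γ := fun s => s.out * t * γ₀ * (φ s.out)⁻¹ * γ₀⁻¹
  refine (Set.finite_range fun s : Γ ⧸ T => if h : u s ∈ T then l ⟨u s, h⟩ else 1).subset ?_
  rintro _ ⟨t', ht', rfl⟩
  have hrel : (twistedConj φ).r ((t : Γ) * γ₀) ((t' : Γ) * γ₀) :=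
    Quotient.exact (ht.trans (Eq.symm ht'))
  obtain ⟨δ, hδ⟩ := hrel
  have hδ' : δ * ((QuotientGroup.mk δ : Γ ⧸ T).out)⁻¹ ∈ T := by
    have h : (QuotientGroup.mk ((QuotientGroup.mk δ : Γ ⧸ T).out) : Γ ⧸ T) = QuotientGroup.mk δ :=
      QuotientGroup.out_eq' _
    have h2 := (QuotientGroup.eq (s := T)).mp h
    have h3 := ‹T.Normal›.conj_mem _ h2 ((QuotientGroup.mk δ : Γ ⧸ T).out)
    simpa [mul_assoc] using h3
  set s := (QuotientGroup.mk δ : Γ ⧸ T) with hs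
  set τ := δ * s.out⁻¹ with hτ
  have hw : γ₀ * φ τ * γ₀⁻¹ ∈ T := ‹T.Normal›.conj_mem _ (hT _ hδ') γ₀
  have hu : u s = τ⁻¹ * t' * (γ₀ * φ τ * γ₀⁻¹) := by
    have h1 : (t' : Γ) = δ * (t * γ₀) * (φ δ)⁻¹ * γ₀⁻¹ := by
      rw [← hδ]; group
    rw [h1, hτ]
    simp only [u, map_mul, map_inv]
    group
  have huT : u s ∈ T := by
    rw [hu]
    exact T.mul_mem (T.mul_mem (T.inv_mem hδ') t'.2) hw
  refine ⟨s, ?_⟩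
  simp only [dif_pos huT]
  have h1 : (⟨u s, huT⟩ : T) = ⟨τ, hδ'⟩⁻¹ * t' * ⟨γ₀ * φ τ * γ₀⁻¹, hw⟩ := Subtype.ext hu
  rw [h1, map_mul, map_mul, map_inv, hinv ⟨τ, hδ'⟩ ⟨γ₀ * φ τ * γ₀⁻¹, hw⟩ rfl]
  rw [mul_comm (l ⟨τ, hδ'⟩)⁻¹, inv_mul_cancel_right]

/-! ### Eigenvectors in odd dimension -/

theorem Polynomial.exists_isRoot_of_monic_of_odd_natDegree {p : Polynomial ℝ} (hp : p.Monic)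
    (hodd : Odd p.natDegree) : ∃ r, p.IsRoot r := by
  have htop : ∀ q : Polynomial ℝ, 0 < q.natDegree → 0 ≤ q.leadingCoeff → ∃ x, 0 ≤ q.eval x := by
    intro q hq hl
    have h := q.tendsto_atTop_of_leadingCoeff_nonneg (Polynomial.natDegree_pos_iff_degree_pos.mp hq)
      hl
    exact (h.eventually_ge_atTop 0).exists
  obtain ⟨a, ha⟩ := htop p hodd.pos (by rw [hp.leadingCoeff]; exact zero_le_one)
  -- Because the degree is odd, `-p(-X)` is again monic; this supplies a point where `p ≤ 0` for the
  -- intermediate value theorem.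
  obtain ⟨b, hb⟩ := htop (-(p.comp (-Polynomial.X)))
    (by simpa [Polynomial.natDegree_comp] using hodd.pos)
    (by simp [Polynomial.leadingCoeff_comp, hp.leadingCoeff, hodd.neg_one_pow])
  have hb' : p.eval (-b) ≤ 0 := by simpa using hb
  obtain ⟨r, hr⟩ := mem_range_of_exists_le_of_exists_ge p.continuous ⟨-b, hb'⟩ ⟨a, ha⟩
  exact ⟨r, hr⟩

section OddDimension

variable {V : Type*} [AddCommGroup V] [Module ℚ V] [FiniteDimensional ℚ V]

/-- The characteristic polynomial has odd degree, hence a real root; finite order makes that root a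
real root of unity, so it is `±1`. Being rational, it is already an eigenvalue over `ℚ`. -/
theorem exists_apply_eq_self_or_neg_of_odd_finrank (f : End ℚ V) {k : ℕ} (hk : k ≠ 0)
    (hf : f ^ k = 1) (hodd : Odd (finrank ℚ V)) : ∃ v ≠ 0, f v = v ∨ f v = -v := by
  let b := finBasis ℚ V
  let M := LinearMap.toMatrix b b f
  let N := M.map (algebraMap ℚ ℝ)
  have hN : N.charpoly = f.charpoly.map (algebraMap ℚ ℝ) := by
    rw [Matrix.charpoly_map, LinearMap.charpoly_toMatrix]
  have hdeg : Odd N.charpoly.natDegree := by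
    rw [Matrix.charpoly_natDegree_eq_dim, Fintype.card_fin]
    exact hodd
  obtain ⟨r, hr⟩ := Polynomial.exists_isRoot_of_monic_of_odd_natDegree N.charpoly_monic hdeg
  have hev : End.HasEigenvalue (Matrix.toLin' N) r := by
    rw [End.hasEigenvalue_iff_isRoot_charpoly, ← Matrix.toLin'_toMatrix' (Matrix.toLin' N)]
    simpa using hr
  obtain ⟨w, hw⟩ := hev.exists_hasEigenvector
  have hNk : N ^ k = 1 := by
    have h : M ^ k = 1 := by
      rw [LinearMap.toMatrix_pow, hf, LinearMap.toMatrix_one]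
    rw [← Matrix.map_pow, h]
    simp
  have hrk : r ^ k = 1 := by
    have h := hw.pow_apply k
    rw [← Matrix.toLin'_pow, hNk, Matrix.toLin'_one] at h
    have h0 : (r ^ k - 1) • w = 0 := by
      rw [sub_smul, one_smul, ← h]; simp
    rcases smul_eq_zero.mp h0 with h | h
    · linarith
    · exact absurd h hw.2
  have key : ∀ c : ℚ, (algebraMap ℚ ℝ c) = r → ∃ v ≠ 0, f v = c • v := by
    intro c hc
    have h : f.charpoly.IsRoot c := by
      rw [hN, ← hc] at hr
      exact (Polynomial.isRoot_map_iff (algebraMap ℚ ℝ).injective).mp hr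
    rw [← End.hasEigenvalue_iff_isRoot_charpoly] at h
    obtain ⟨v, hv⟩ := h.exists_hasEigenvector
    exact ⟨v, hv.2, hv.apply_eq_smul⟩
  have habs : |r| = 1 := by
    have : |r| ^ k = 1 := by rw [← abs_pow, hrk, abs_one]
    exact (pow_eq_one_iff_of_nonneg (abs_nonneg r) hk).mp this
  rcases eq_or_eq_neg_of_abs_eq habs with h | h
  · obtain ⟨v, hv, hfv⟩ := key 1 (by simp [h])
    exact ⟨v, hv, Or.inl (by simpa using hfv)⟩
  · obtain ⟨v, hv, hfv⟩ := key (-1) (by simp [h])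
    exact ⟨v, hv, Or.inr (by simpa using hfv)⟩

/-- Commuting automorphisms of finite order of an odd-dimensional rational vector space have a
common eigenvector. -/
theorem exists_common_eigenvector_of_odd_finrank (A : Set (End ℚ V))
    (hcomm : ∀ a ∈ A, ∀ b ∈ A, a * b = b * a) (hfin : ∀ a ∈ A, ∃ k ≠ 0, a ^ k = 1)
    (hodd : Odd (finrank ℚ V)) : ∃ v ≠ 0, ∀ a ∈ A, a v = v ∨ a v = -v := by
  -- An `A`-invariant `U` of minimal odd dimension works: every element of `A` acts on it as a
  -- scalar `±1`.
  let P : Submodule ℚ V → Prop := fun U => Odd (finrank ℚ U) ∧ ∀ a ∈ A, ∀ u ∈ U, a u ∈ U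
  have hne : ∃ d, ∃ U, P U ∧ finrank ℚ U = d :=
    ⟨_, ⊤, ⟨by rwa [finrank_top], by simp⟩, rfl⟩
  classical
  obtain ⟨U, ⟨hUodd, hUA⟩, hUd⟩ := Nat.find_spec hne
  have hmin : ∀ U', P U' → finrank ℚ U ≤ finrank ℚ U' := by
    intro U' hU'
    rw [hUd]
    exact Nat.find_min' hne ⟨U', hU', rfl⟩
  have hdich : ∀ a ∈ A, ∀ c : ℚ, (∃ u ∈ U, u ≠ 0 ∧ a u = c • u) → ∀ u ∈ U, a u = c • u := by
    intro a ha c ⟨u, huU, hu0, hau⟩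
    let g : V →ₗ[ℚ] V := a - c • LinearMap.id
    have hg : ∀ x, g x = a x - c • x := fun x => by simp [g]
    let h := g.domRestrict U
    have hrn := h.finrank_range_add_finrank_ker
    have hrange : LinearMap.range h = U.map g := by
      ext x; simp [h]
    have hker : (LinearMap.ker h).map U.subtype = U ⊓ LinearMap.ker g := by
      ext x
      simp [h, and_comm]
    have hkf : finrank ℚ (LinearMap.ker h) = finrank ℚ (U ⊓ LinearMap.ker g : Submodule ℚ V) := by
      rw [← hker]
      exact (LinearEquiv.finrank_eq (Submodule.equivMapOfInjective _ U.injective_subtype _))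
    rw [hrange, hkf] at hrn
    have hgA : ∀ b ∈ A, ∀ x, b (g x) = g (b x) := by
      intro b hb x
      have := LinearMap.congr_fun (hcomm a ha b hb) x
      simp only [End.mul_apply] at this
      rw [hg, hg, map_sub, map_smul, this]
    have hkpos : 0 < finrank ℚ (U ⊓ LinearMap.ker g : Submodule ℚ V) := by
      rw [finrank_pos_iff_exists_ne_zero]
      exact ⟨⟨u, huU, by simp [hg, hau]⟩, fun h0 => hu0 (congrArg Subtype.val h0)⟩
    have hmapA : ∀ b ∈ A, ∀ x ∈ U.map g, b x ∈ U.map g := by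
      rintro b hb _ ⟨x, hx, rfl⟩
      exact ⟨b x, hUA b hb x hx, (hgA b hb x).symm⟩
    have hkerA : ∀ b ∈ A, ∀ x ∈ U ⊓ LinearMap.ker g, b x ∈ U ⊓ LinearMap.ker g := by
      rintro b hb x ⟨hx, hx'⟩
      refine ⟨hUA b hb x hx, ?_⟩
      have hx'' : g x = 0 := hx'
      change g (b x) = 0
      rw [← hgA b hb, hx'', map_zero]
    -- Kernel and image of `a - c` on `U` are invariant and one of them has odd dimension. The image
    -- is smaller than `U`, so minimality rules it out and the kernel is all of `U`.
    have hle : finrank ℚ U ≤ finrank ℚ (U ⊓ LinearMap.ker g : Submodule ℚ V) := by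
      rcases Nat.even_or_odd (finrank ℚ (U ⊓ LinearMap.ker g : Submodule ℚ V)) with he | ho
      · have ho : Odd (finrank ℚ (U.map g)) := by
          rw [← hrn] at hUodd
          exact (Nat.odd_add.mp hUodd).mpr he
        have := hmin _ ⟨ho, hmapA⟩
        omega
      · exact hmin _ ⟨ho, hkerA⟩
    have hEq : U ⊓ LinearMap.ker g = U := Submodule.eq_of_le_of_finrank_le inf_le_left hle
    intro x hx
    rw [← hEq] at hx
    have hx' : g x = 0 := hx.2
    rw [hg] at hx'
    exact sub_eq_zero.mp hx'
  have : Nontrivial U := by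
    apply nontrivial_of_finrank_pos (R := ℚ)
    exact hUodd.pos
  obtain ⟨u, hu⟩ := exists_ne (0 : U)
  refine ⟨u, by simpa using hu, fun a ha => ?_⟩
  obtain ⟨k, hk, hak⟩ := hfin a ha
  have hrest : (a.restrict (hUA a ha)) ^ k = 1 := by
    ext x
    rw [Module.End.pow_restrict]
    simp [hak]
  obtain ⟨v, hv0, hv⟩ := exists_apply_eq_self_or_neg_of_odd_finrank _ hk hrest hUodd
  have hv0' : (v : V) ≠ 0 := by simpa using hv0
  rcases hv with hv | hv
  · left
    have := hdich a ha 1 ⟨v, v.2, hv0', by simpa using congrArg Subtype.val hv⟩ u u.2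
    simpa using this
  · right
    have := hdich a ha (-1) ⟨v, v.2, hv0', by simpa using congrArg Subtype.val hv⟩ u u.2
    simpa using this

end OddDimension

/-! ### An abelian subgroup stable under the normalizer -/

section Commutators

variable {G : Type*} [Group G]

/-- Carries stability under `g`, which need not lie in the group, down the derived series. -/
theorem conj_mem_commutator {g : G} {H : Subgroup G} (hg : ∀ h ∈ H, g * h * g⁻¹ ∈ H) :
    ∀ h ∈ ⁅H, H⁆, g * h * g⁻¹ ∈ ⁅H, H⁆ := by
  intro h hh
  have hle : H.map (MulAut.conj g).toMonoidHom ≤ H := by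
    rintro _ ⟨x, hx, rfl⟩
    exact hg x hx
  have h1 := Subgroup.map_commutator H H (MulAut.conj g).toMonoidHom
  have h2 : (⁅H, H⁆).map (MulAut.conj g).toMonoidHom ≤ ⁅H, H⁆ := by
    rw [h1]
    exact Subgroup.commutator_mono hle hle
  exact h2 ⟨h, hh, rfl⟩

end Commutators

section SignScalars

variable {V : Type*} [AddCommGroup V] [Module ℚ V]

/-- A linear automorphism is a sign scalar if it is `1` or `-1`. -/
def IsSignScalar (s : V ≃ₗ[ℚ] V) : Prop := (∀ v, s v = v) ∨ ∀ v, s v = -v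

theorem IsSignScalar.commute {s : V ≃ₗ[ℚ] V} (hs : IsSignScalar s) (t : V ≃ₗ[ℚ] V) :
    s * t = t * s := by
  ext v
  rcases hs with h | h <;> simp [LinearEquiv.mul_apply, h]

theorem IsSignScalar.mul_self {s : V ≃ₗ[ℚ] V} (hs : IsSignScalar s) : s * s = 1 := by
  ext v
  rcases hs with h | h <;> simp [LinearEquiv.mul_apply, h]

theorem exists_pow_toLinearMap_eq_one (S : Subgroup (V ≃ₗ[ℚ] V)) [Finite S] {s : V ≃ₗ[ℚ] V}
    (hs : s ∈ S) : ∃ k ≠ 0, (s : End ℚ V) ^ k = 1 := by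
  have h := isOfFinOrder_of_finite (⟨s, hs⟩ : S)
  refine ⟨orderOf (⟨s, hs⟩ : S), h.orderOf_pos.ne', ?_⟩
  have h1 : s ^ orderOf (⟨s, hs⟩ : S) = 1 :=
    congrArg Subtype.val (pow_orderOf_eq_one (⟨s, hs⟩ : S))
  have h2 : ∀ n : ℕ, ((s ^ n : V ≃ₗ[ℚ] V) : End ℚ V) = (s : End ℚ V) ^ n := by
    intro n
    exact map_pow (LinearEquiv.automorphismGroup.toLinearMapMonoidHom : (V ≃ₗ[ℚ] V) →* (V →ₗ[ℚ] V)) s n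
  rw [← h2, h1]
  rfl

/-- A finite solvable group of automorphisms of an odd-dimensional rational vector space which does
not consist of sign scalars has an abelian subgroup with the same property which is stable under
all conjugations preserving the group. -/
theorem exists_commutative_subgroup_not_isSignScalar [FiniteDimensional ℚ V]
    (S : Subgroup (V ≃ₗ[ℚ] V)) [Finite S] [Group.IsSolvable S] (hodd : Odd (finrank ℚ V))
    (hS : ¬ ∀ s ∈ S, IsSignScalar s) :
    ∃ A ≤ S, (∀ a ∈ A, ∀ b ∈ A, a * b = b * a) ∧ (¬ ∀ a ∈ A, IsSignScalar a) ∧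
      ∀ g : V ≃ₗ[ℚ] V, (∀ s ∈ S, g * s * g⁻¹ ∈ S) → (∀ s ∈ S, g⁻¹ * s * g ∈ S) →
        ∀ a ∈ A, g * a * g⁻¹ ∈ A := by
  classical
  let D : ℕ → Subgroup (V ≃ₗ[ℚ] V) := fun k => (derivedSeries S k).map S.subtype
  have hD0 : D 0 = S := by
    simp only [D, derivedSeries_zero, ← MonoidHom.range_eq_map, Subgroup.range_subtype]
  have hDsucc : ∀ k, D (k + 1) = ⁅D k, D k⁆ := by
    intro k
    simp only [D, derivedSeries_succ, Subgroup.map_commutator]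
  have hex : ∃ k, ∀ s ∈ D k, IsSignScalar s := by
    obtain ⟨k, hk⟩ := Group.IsSolvable.solvable (G := S)
    refine ⟨k, ?_⟩
    simp only [D, hk, Subgroup.map_bot, Subgroup.mem_bot]
    rintro _ rfl
    exact Or.inl fun v => rfl
  -- `D k` is the last term of the derived series not consisting of sign scalars, so commutators in
  -- it are signs. The subgroup sought is the centre of `D k`.
  obtain ⟨k, hk⟩ : ∃ k, Nat.find hex = k + 1 := by
    refine Nat.exists_eq_succ_of_ne_zero fun h0 => hS ?_
    have := Nat.find_spec hex
    rwa [h0, hD0] at this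
  have hsucc : ∀ s ∈ ⁅D k, D k⁆, IsSignScalar s := by
    have := Nat.find_spec hex
    rwa [hk, hDsucc] at this
  have hB : ¬ ∀ s ∈ D k, IsSignScalar s := Nat.find_min hex (by omega)
  have hBS : D k ≤ S := by
    rintro _ ⟨x, -, rfl⟩
    exact x.2
  have hconj : ∀ g : V ≃ₗ[ℚ] V, (∀ s ∈ S, g * s * g⁻¹ ∈ S) → ∀ j, ∀ s ∈ D j, g * s * g⁻¹ ∈ D j := by
    intro g hg j
    induction j with
    | zero => rwa [hD0]
    | succ j ih =>
      rw [hDsucc]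
      exact conj_mem_commutator ih
  have hconjB : ∀ g : V ≃ₗ[ℚ] V, (∀ s ∈ S, g * s * g⁻¹ ∈ S) → ∀ s ∈ D k, g * s * g⁻¹ ∈ D k :=
    fun g hg => hconj g hg k
  generalize D k = B at hsucc hB hBS hconjB
  let A : Subgroup (V ≃ₗ[ℚ] V) := B ⊓ Subgroup.centralizer (B : Set (V ≃ₗ[ℚ] V))
  have hmemA : ∀ a, a ∈ A ↔ a ∈ B ∧ ∀ b ∈ B, b * a = a * b := by
    intro a
    simp [A, Subgroup.mem_inf, Subgroup.mem_centralizer_iff]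
  -- An eigenvector of `s` with eigenvalue `±1` is fixed by `s²`, so `s² = -1` cannot occur in odd
  -- dimension.
  have hnoneg : ∀ s ∈ S, ¬ ∀ v, s (s v) = -v := by
    intro s hs h
    obtain ⟨n, hn, hsn⟩ := exists_pow_toLinearMap_eq_one S hs
    obtain ⟨v, hv, hsv⟩ := exists_apply_eq_self_or_neg_of_odd_finrank _ hn hsn hodd
    have hv2 : s (s v) = v := by
      rcases hsv with h | h
      · have h : s v = v := h
        rw [h, h]
      · have h : s v = -v := h
        rw [h, map_neg, h, neg_neg]
    rw [h v] at hv2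
    have h2 : (2 : ℚ) • v = 0 := by rw [two_smul]; nth_rewrite 1 [← hv2]; exact neg_add_cancel v
    exact hv ((smul_eq_zero.mp h2).resolve_left two_ne_zero)
  refine ⟨A, inf_le_left.trans hBS, ?_, ?_, ?_⟩
  · intro a ha b hb
    exact ((hmemA b).mp hb).2 a ((hmemA a).mp ha).1
  · intro hA
    -- Assume the centre consists of signs. Since `c b = ± b c`, each `b²` is central, hence `±1`,
    -- hence `1`. A group of exponent two is abelian, so `B` equals its centre and consists of
    -- signs, a contradiction.
    have hsq : ∀ b ∈ B, b * b = 1 := by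
      intro b hb
      have hbb : b * b ∈ A := by
        refine (hmemA _).mpr ⟨B.mul_mem hb hb, fun c hc => ?_⟩
        have hs := hsucc _ (Subgroup.commutator_mem_commutator hc hb)
        have h1 : c * b = ⁅c, b⁆ * (b * c) := by
          rw [commutatorElement_def]; group
        have h2 := hs.commute b
        calc c * (b * b) = ⁅c, b⁆ * (b * c) * b := by rw [← h1, mul_assoc]
          _ = ⁅c, b⁆ * b * (c * b) := by simp only [mul_assoc]
          _ = ⁅c, b⁆ * b * (⁅c, b⁆ * (b * c)) := by rw [← h1]
          _ = ⁅c, b⁆ * (b * ⁅c, b⁆) * (b * c) := by simp only [mul_assoc]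
          _ = ⁅c, b⁆ * ⁅c, b⁆ * (b * (b * c)) := by rw [← h2]; simp only [mul_assoc]
          _ = b * b * c := by rw [hs.mul_self, one_mul, mul_assoc]
      rcases hA _ hbb with h | h
      · ext v
        exact h v
      · exact absurd h (hnoneg b (hBS hb))
    refine hB fun s hs => hA s ((hmemA s).mpr ⟨hs, fun b hb => ?_⟩)
    have h1 := hsq _ (B.mul_mem hb hs)
    have h2 : b * s = (b * s)⁻¹ := eq_inv_of_mul_eq_one_left h1
    rw [h2, mul_inv_rev, inv_eq_of_mul_eq_one_left (hsq s hs), inv_eq_of_mul_eq_one_left (hsq b hb)]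
  · intro g hg hg' a ha
    obtain ⟨haB, hac⟩ := (hmemA a).mp ha
    refine (hmemA _).mpr ⟨hconjB g hg a haB, fun b hb => ?_⟩
    have hb' : g⁻¹ * b * g ∈ B := by
      have := hconjB g⁻¹ (by simpa using hg') b hb
      simpa using this
    have h := hac _ hb'
    calc b * (g * a * g⁻¹) = g * ((g⁻¹ * b * g) * a) * g⁻¹ := by group
      _ = g * a * g⁻¹ * b := by rw [h]; group

end SignScalars

/-! ### Sign eigenspaces as blocks of imprimitivity -/

section Blocks

variable {V : Type*} [AddCommGroup V] [Module ℚ V]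

/-- The simultaneous eigenspace of a set of automorphisms for a family of eigenvalues. -/
def simultaneousEigenspace (A : Subgroup (V ≃ₗ[ℚ] V)) (χ : A → ℚ) : Submodule ℚ V :=
  ⨅ a : A, End.eigenspace ((a : V ≃ₗ[ℚ] V) : End ℚ V) (χ a)

theorem mem_simultaneousEigenspace {A : Subgroup (V ≃ₗ[ℚ] V)} {χ : A → ℚ} {v : V} :
    v ∈ simultaneousEigenspace A χ ↔ ∀ a : A, (a : V ≃ₗ[ℚ] V) v = χ a • v := by
  simp [simultaneousEigenspace, Submodule.mem_iInf]

/-- They lie inside the intersections of maximal generalized eigenspaces, which are independent for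
commuting operators. -/
theorem iSupIndep_simultaneousEigenspace {A : Subgroup (V ≃ₗ[ℚ] V)}
    (hcomm : ∀ a ∈ A, ∀ b ∈ A, a * b = b * a) : iSupIndep (simultaneousEigenspace A) := by
  have h : ∀ i j : A, Commute ((i : V ≃ₗ[ℚ] V) : End ℚ V) ((j : V ≃ₗ[ℚ] V) : End ℚ V) := by
    intro i j
    ext v
    exact LinearEquiv.congr_fun (hcomm i i.2 j j.2) v
  refine (End.independent_iInf_maxGenEigenspace_of_forall_mapsTo
    (fun a : A => ((a : V ≃ₗ[ℚ] V) : End ℚ V))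
    fun i j φ => End.mapsTo_maxGenEigenspace_of_comm (h j i) φ).mono fun χ => ?_
  exact iInf_mono fun a => End.eigenspace_le_maxGenEigenspace

/-- The nonzero simultaneous eigenspaces with eigenvalues `±1`. -/
def signBlocks (A : Subgroup (V ≃ₗ[ℚ] V)) : Set (Submodule ℚ V) :=
  {W | W ≠ ⊥ ∧ ∃ χ : A → ℚ, (∀ a, χ a = 1 ∨ χ a = -1) ∧ W = simultaneousEigenspace A χ}

theorem sSupIndep_signBlocks {A : Subgroup (V ≃ₗ[ℚ] V)}
    (hcomm : ∀ a ∈ A, ∀ b ∈ A, a * b = b * a) : sSupIndep (signBlocks A) := by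
  refine (iSupIndep_simultaneousEigenspace hcomm).sSupIndep_range.mono ?_
  rintro W ⟨-, χ, -, rfl⟩
  exact ⟨χ, rfl⟩

/-- An element normalizing `A` sends the eigenspace of `χ` to that of `χ` twisted by conjugation,
which still has values `±1`. -/
theorem map_mem_signBlocks {A : Subgroup (V ≃ₗ[ℚ] V)} {g : V ≃ₗ[ℚ] V}
    (hg : ∀ a ∈ A, g * a * g⁻¹ ∈ A) (hg' : ∀ a ∈ A, g⁻¹ * a * g ∈ A) {W : Submodule ℚ V}
    (hW : W ∈ signBlocks A) : W.map (g : V →ₗ[ℚ] V) ∈ signBlocks A := by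
  obtain ⟨hW0, χ, hχ, rfl⟩ := hW
  refine ⟨?_, fun a => χ ⟨g⁻¹ * a * g, hg' a a.2⟩, fun a => hχ _, ?_⟩
  · exact ((Submodule.map_injective_of_injective g.injective).ne_iff' (Submodule.map_bot _)).mpr hW0
  · ext v
    rw [mem_simultaneousEigenspace]
    constructor
    · rintro ⟨w, hw, rfl⟩ a
      have h := mem_simultaneousEigenspace.mp hw ⟨g⁻¹ * a * g, hg' a a.2⟩
      have h2 := congrArg g h
      simpa [LinearEquiv.mul_apply] using h2
    · intro hv
      refine ⟨g⁻¹ v, mem_simultaneousEigenspace.mpr fun a => ?_, g.apply_symm_apply v⟩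
      have h := congrArg (g⁻¹ : V ≃ₗ[ℚ] V) (hv ⟨g * a * g⁻¹, hg a a.2⟩)
      have h3 : (⟨g⁻¹ * (g * a * g⁻¹) * g, hg' _ (hg a a.2)⟩ : A) = a :=
        Subtype.ext (by group)
      simp only [h3, map_smul] at h
      rw [← h]
      simp [LinearEquiv.mul_apply]

theorem signBlocks_nonempty [FiniteDimensional ℚ V] {A : Subgroup (V ≃ₗ[ℚ] V)} [Finite A]
    (hcomm : ∀ a ∈ A, ∀ b ∈ A, a * b = b * a) (hodd : Odd (finrank ℚ V)) :
    (signBlocks A).Nonempty := by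
  obtain ⟨v, hv0, hv⟩ := exists_common_eigenvector_of_odd_finrank
    ((fun a : V ≃ₗ[ℚ] V => (a : End ℚ V)) '' A) (by
      rintro _ ⟨a, ha, rfl⟩ _ ⟨b, hb, rfl⟩
      ext v
      exact LinearEquiv.congr_fun (hcomm a ha b hb) v) (by
      rintro _ ⟨a, ha, rfl⟩
      exact exists_pow_toLinearMap_eq_one A ha) hodd
  classical
  let χ : A → ℚ := fun a => if (a : V ≃ₗ[ℚ] V) v = v then 1 else -1
  refine ⟨simultaneousEigenspace A χ, ?_, χ, fun a => ?_, rfl⟩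
  · rw [Submodule.ne_bot_iff]
    refine ⟨v, mem_simultaneousEigenspace.mpr fun a => ?_, hv0⟩
    by_cases h : (a : V ≃ₗ[ℚ] V) v = v
    · simp [χ, h]
    · have h2 : (a : V ≃ₗ[ℚ] V) v = -v := (hv _ ⟨a, a.2, rfl⟩).resolve_left h
      simp only [χ, if_neg h, h2, neg_smul, one_smul]
  · by_cases h : (a : V ≃ₗ[ℚ] V) v = v
    · simp [χ, h]
    · simp [χ, h]

theorem signBlocks_apply {A : Subgroup (V ≃ₗ[ℚ] V)} {W : Submodule ℚ V} (hW : W ∈ signBlocks A)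
    {a : V ≃ₗ[ℚ] V} (ha : a ∈ A) : (∀ w ∈ W, a w = w) ∨ ∀ w ∈ W, a w = -w := by
  obtain ⟨-, χ, hχ, rfl⟩ := hW
  rcases hχ ⟨a, ha⟩ with h | h
  · exact Or.inl fun w hw => by simpa [h] using mem_simultaneousEigenspace.mp hw ⟨a, ha⟩
  · exact Or.inr fun w hw => by simpa [h] using mem_simultaneousEigenspace.mp hw ⟨a, ha⟩

/-- No proper nonzero subspace is invariant under `S`. -/
def ActsIrreducibly (S : Subgroup (V ≃ₗ[ℚ] V)) : Prop :=
  ∀ U : Submodule ℚ V, (∀ s ∈ S, ∀ u ∈ U, s u ∈ U) → U = ⊥ ∨ U = ⊤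

theorem ActsIrreducibly.iSup_map_eq_top {S : Subgroup (V ≃ₗ[ℚ] V)} (hS : ActsIrreducibly S)
    {W : Submodule ℚ V} (hW : W ≠ ⊥) :
    ⨆ s : S, W.map ((s : V ≃ₗ[ℚ] V) : V →ₗ[ℚ] V) = ⊤ := by
  refine (hS _ ?_).resolve_left ?_
  · intro s hs u hu
    have hle : (⨆ t : S, W.map ((t : V ≃ₗ[ℚ] V) : V →ₗ[ℚ] V)).map (s : V →ₗ[ℚ] V) ≤
        ⨆ t : S, W.map ((t : V ≃ₗ[ℚ] V) : V →ₗ[ℚ] V) := by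
      rw [Submodule.map_iSup]
      refine iSup_le fun t => ?_
      refine le_trans (le_of_eq ?_)
        (le_iSup (fun t : S => W.map ((t : V ≃ₗ[ℚ] V) : V →ₗ[ℚ] V)) (⟨s, hs⟩ * t))
      rw [← Submodule.map_comp]
      rfl
    exact hle ⟨u, hu, rfl⟩
  · intro h
    refine hW (le_bot_iff.mp ?_)
    rw [← h]
    refine le_trans (le_of_eq ?_)
      (le_iSup (fun t : S => W.map ((t : V ≃ₗ[ℚ] V) : V →ₗ[ℚ] V)) 1)
    exact (Submodule.map_id W).symm

/-- The translates of `W` span `V`. If none were `W'`, the members other than `W'` would span `V`,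
and independence would force `W' = ⊥`. -/
theorem ActsIrreducibly.exists_map_eq {S : Subgroup (V ≃ₗ[ℚ] V)} (hS : ActsIrreducibly S)
    {B : Set (Submodule ℚ V)} (hind : sSupIndep B) (hbot : ⊥ ∉ B)
    (hmap : ∀ s ∈ S, ∀ W ∈ B, W.map (s : V →ₗ[ℚ] V) ∈ B) {W W' : Submodule ℚ V}
    (hW : W ∈ B) (hW' : W' ∈ B) : ∃ s ∈ S, W.map (s : V →ₗ[ℚ] V) = W' := by
  by_contra! hne
  have hW0 : W ≠ ⊥ := fun h => hbot (h ▸ hW)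
  have hle : (⊤ : Submodule ℚ V) ≤ sSup (B \ {W'}) := by
    rw [← hS.iSup_map_eq_top hW0]
    exact iSup_le fun s => le_sSup ⟨hmap s s.2 W hW, hne s s.2⟩
  have hdis := hind hW'
  rw [top_le_iff.mp hle, disjoint_top] at hdis
  exact hbot (hdis ▸ hW')

/-- By transitivity `V` is a direct sum of finitely many blocks of equal dimension. Thus blocks of
an odd-dimensional space are odd-dimensional, which keeps the induction going. -/
theorem ActsIrreducibly.finrank_dvd [FiniteDimensional ℚ V] {S : Subgroup (V ≃ₗ[ℚ] V)} [Finite S]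
    (hS : ActsIrreducibly S)
    {B : Set (Submodule ℚ V)} (hind : sSupIndep B) (hbot : ⊥ ∉ B)
    (hmap : ∀ s ∈ S, ∀ W ∈ B, W.map (s : V →ₗ[ℚ] V) ∈ B) {W : Submodule ℚ V}
    (hW : W ∈ B) : finrank ℚ W ∣ finrank ℚ V := by
  classical
  have hfin : Finite B := by
    refine Finite.of_surjective (fun s : S => (⟨_, hmap s s.2 W hW⟩ : B)) ?_
    rintro ⟨W', hW'⟩
    obtain ⟨s, hs, h⟩ := hS.exists_map_eq hind hbot hmap hW hW'
    exact ⟨⟨s, hs⟩, Subtype.ext h⟩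
  have := Fintype.ofFinite B
  have hi : iSupIndep (fun W : B => (W : Submodule ℚ V)) := (sSupIndep_iff B).mp hind
  have htop : ⨆ W : B, (W : Submodule ℚ V) = ⊤ := by
    rw [eq_top_iff, ← hS.iSup_map_eq_top (W := W) fun h => hbot (h ▸ hW)]
    exact iSup_le fun s => le_iSup (fun W : B => (W : Submodule ℚ V)) ⟨_, hmap s s.2 W hW⟩
  have hint := DirectSum.isInternal_submodule_of_iSupIndep_of_iSup_eq_top hi htop
  have he := (LinearEquiv.ofBijective (DirectSum.coeLinearMap fun W : B => (W : Submodule ℚ V))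
    hint).finrank_eq
  rw [finrank_directSum] at he
  have hconst : ∀ W' : B, finrank ℚ (W' : Submodule ℚ V) = finrank ℚ W := by
    rintro ⟨W', hW'⟩
    obtain ⟨s, hs, h⟩ := hS.exists_map_eq hind hbot hmap hW hW'
    subst h
    exact (LinearEquiv.finrank_eq (Submodule.equivMapOfInjective _ s.injective W)).symm
  rw [← he, Finset.sum_congr rfl fun W' _ => hconst W', Finset.sum_const, smul_eq_mul]
  exact Dvd.intro_left _ rfl

end Blocks

/-! ### The group induced on a block -/

section Restriction

variable {V : Type*} [AddCommGroup V] [Module ℚ V]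

/-- The automorphisms preserving a subspace. -/
def subspaceStabilizer (W : Submodule ℚ V) : Subgroup (V ≃ₗ[ℚ] V) where
  carrier := {g | W.map (g : V →ₗ[ℚ] V) = W}
  one_mem' := Submodule.map_id W
  mul_mem' := by
    intro a b ha hb
    have ha : W.map (a : V →ₗ[ℚ] V) = W := ha
    have hb : W.map (b : V →ₗ[ℚ] V) = W := hb
    change W.map ((a : V →ₗ[ℚ] V) ∘ₗ (b : V →ₗ[ℚ] V)) = W
    rw [Submodule.map_comp, hb, ha]
  inv_mem' := by
    intro a ha
    have ha : W.map (a : V →ₗ[ℚ] V) = W := ha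
    change W.map ((a⁻¹ : V ≃ₗ[ℚ] V) : V →ₗ[ℚ] V) = W
    nth_rewrite 1 [← ha]
    rw [← Submodule.map_comp]
    have : ((a⁻¹ : V ≃ₗ[ℚ] V) : V →ₗ[ℚ] V) ∘ₗ (a : V →ₗ[ℚ] V) = LinearMap.id := by
      ext v
      exact a.symm_apply_apply v
    rw [this, Submodule.map_id]

theorem mem_subspaceStabilizer {W : Submodule ℚ V} {g : V ≃ₗ[ℚ] V} :
    g ∈ subspaceStabilizer W ↔ W.map (g : V →ₗ[ℚ] V) = W := Iff.rfl

/-- Restriction of automorphisms to an invariant subspace. -/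
def restrictToSubspace (W : Submodule ℚ V) : subspaceStabilizer W →* (W ≃ₗ[ℚ] W) where
  toFun g := LinearEquiv.ofSubmodules (g : V ≃ₗ[ℚ] V) W W g.2
  map_one' := by ext; rfl
  map_mul' _ _ := by ext; rfl

/-- The group induced on `W` by the stabilizer of `W` in `S`. -/
def inducedGroup (S : Subgroup (V ≃ₗ[ℚ] V)) (W : Submodule ℚ V) : Subgroup (W ≃ₗ[ℚ] W) :=
  (S.subgroupOf (subspaceStabilizer W)).map (restrictToSubspace W)

instance (S : Subgroup (V ≃ₗ[ℚ] V)) [Finite S] (W : Submodule ℚ V) : Finite (inducedGroup S W) := by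
  have : Finite (S.subgroupOf (subspaceStabilizer W)) :=
    Finite.of_injective (fun x => (⟨x.1.1, x.2⟩ : S)) fun x y h =>
      Subtype.ext (Subtype.ext (congrArg (fun z : S => (z : V ≃ₗ[ℚ] V)) h))
  exact Set.Finite.image _ this

instance (S : Subgroup (V ≃ₗ[ℚ] V)) [Group.IsSolvable S] (W : Submodule ℚ V) :
    Group.IsSolvable (inducedGroup S W) := by
  let i : S.subgroupOf (subspaceStabilizer W) →* S :=
    { toFun := fun x => ⟨x.1.1, x.2⟩
      map_one' := rfl
      map_mul' := fun _ _ => rfl }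
  have : Group.IsSolvable (S.subgroupOf (subspaceStabilizer W)) :=
    Group.isSolvable_of_isSolvable_injective (f := i) fun x y h =>
      Subtype.ext (Subtype.ext (congrArg (fun z : S => (z : V ≃ₗ[ℚ] V)) h))
  exact Group.isSolvable_of_surjective
    ((restrictToSubspace W).subgroupMap_surjective (S.subgroupOf (subspaceStabilizer W)))

theorem mem_inducedGroup {S : Subgroup (V ≃ₗ[ℚ] V)} {W : Submodule ℚ V} {u : W ≃ₗ[ℚ] W} :
    u ∈ inducedGroup S W ↔
      ∃ g : subspaceStabilizer W, (g : V ≃ₗ[ℚ] V) ∈ S ∧ restrictToSubspace W g = u := by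
  simp [inducedGroup, Subgroup.mem_map, Subgroup.mem_subgroupOf]

theorem conj_mem_inducedGroup {S : Subgroup (V ≃ₗ[ℚ] V)} {W : Submodule ℚ V}
    (g : subspaceStabilizer W) (hg : ∀ s ∈ S, (g : V ≃ₗ[ℚ] V) * s * (g : V ≃ₗ[ℚ] V)⁻¹ ∈ S)
    {u : W ≃ₗ[ℚ] W} (hu : u ∈ inducedGroup S W) :
    restrictToSubspace W g * u * (restrictToSubspace W g)⁻¹ ∈ inducedGroup S W := by
  obtain ⟨h, hh, rfl⟩ := mem_inducedGroup.mp hu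
  refine mem_inducedGroup.mpr ⟨g * h * g⁻¹, ?_, ?_⟩
  · rw [Subgroup.coe_mul, Subgroup.coe_mul, Subgroup.coe_inv]
    exact hg _ hh
  · rw [map_mul, map_mul, map_inv]

/-- For an invariant nonzero `U` in `W`, a translate by `s` stays in `U` if `s W = W` and lies in
another block otherwise. So `V` is the sum of `U` and the other blocks, and the modular law gives `U
= W`. -/
theorem ActsIrreducibly.inducedGroup {S : Subgroup (V ≃ₗ[ℚ] V)} (hS : ActsIrreducibly S)
    {B : Set (Submodule ℚ V)} (hind : sSupIndep B)
    (hmap : ∀ s ∈ S, ∀ W ∈ B, W.map (s : V →ₗ[ℚ] V) ∈ B) {W : Submodule ℚ V}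
    (hW : W ∈ B) : ActsIrreducibly (inducedGroup S W) := by
  intro U hU
  by_cases hU0 : U = ⊥
  · exact Or.inl hU0
  right
  let U' := U.map W.subtype
  have hU'0 : U' ≠ ⊥ := by
    exact ((Submodule.map_injective_of_injective W.injective_subtype).ne_iff'
      (Submodule.map_bot _)).mpr hU0
  have hU'W : U' ≤ W := Submodule.map_subtype_le W U
  have hle : (⊤ : Submodule ℚ V) ≤ U' ⊔ sSup (B \ {W}) := by
    rw [← hS.iSup_map_eq_top hU'0]
    refine iSup_le fun s => ?_
    by_cases hs : W.map ((s : V ≃ₗ[ℚ] V) : V →ₗ[ℚ] V) = W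
    · refine le_trans ?_ le_sup_left
      rintro _ ⟨_, ⟨u, hu, rfl⟩, rfl⟩
      exact ⟨_, hU _ (mem_inducedGroup.mpr ⟨⟨s, hs⟩, s.2, rfl⟩) u hu, rfl⟩
    · refine le_trans (Submodule.map_mono hU'W) (le_trans ?_ le_sup_right)
      exact le_sSup ⟨hmap s s.2 W hW, hs⟩
  have hWU : W ≤ U' := by
    have h1 : W ⊓ (U' ⊔ sSup (B \ {W})) = U' ⊔ W ⊓ sSup (B \ {W}) := by
      rw [inf_comm, sup_inf_assoc_of_le _ hU'W, inf_comm]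
    rw [top_le_iff.mp hle, inf_top_eq, disjoint_iff.mp (hind hW), sup_bot_eq] at h1
    exact h1.le
  rw [eq_top_iff]
  intro w _
  obtain ⟨u, hu, huw⟩ := hWU w.2
  have : u = w := Subtype.ext huw
  exact this ▸ hu

end Restriction

/-! ### Fixed vectors in the coset `S F` -/

theorem Rat.eq_one_or_neg_one_of_isIntegral {c : ℚ} (hc0 : c ≠ 0) (hc : IsIntegral ℤ c)
    (hc' : IsIntegral ℤ c⁻¹) : c = 1 ∨ c = -1 := by
  obtain ⟨m, hm⟩ := IsIntegrallyClosed.isIntegral_iff.mp hc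
  obtain ⟨m', hm'⟩ := IsIntegrallyClosed.isIntegral_iff.mp hc'
  have h : m * m' = 1 := by
    have : (m : ℚ) * m' = 1 := by
      simp only [eq_intCast] at hm hm'
      rw [hm, hm', mul_inv_cancel₀ hc0]
    exact_mod_cast this
  rcases Int.eq_one_or_neg_one_of_mul_eq_one h with h | h
  · left; simpa [h] using hm.symm
  · right; simpa [h] using hm.symm

/-- The case of a group of sign scalars. -/
theorem exists_fixed_vector_of_isSignScalar {V : Type*} [AddCommGroup V] [Module ℚ V]
    [Nontrivial V] (S : Subgroup (V ≃ₗ[ℚ] V)) (hirr : ActsIrreducibly S) (hS : S ≠ ⊥)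
    (hsign : ∀ s ∈ S, IsSignScalar s) (F : V ≃ₗ[ℚ] V) (L : Submodule ℤ V) (hfg : L.FG)
    (hfull : ∀ v : V, ∃ k : ℤ, k ≠ 0 ∧ k • v ∈ L)
    (hF : ∀ l ∈ L, F l ∈ L) (hF' : ∀ l ∈ L, F⁻¹ l ∈ L) :
    ∃ s ∈ S, ∃ v ≠ 0, s (F v) = v := by
  obtain ⟨v, hv⟩ := exists_ne (0 : V)
  -- Sign scalars preserve every line, so irreducibility makes `V` one-dimensional and `F` a scalar
  -- `c`. The lattice makes `c` and `c⁻¹` integral.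
  have htop : Submodule.span ℚ {v} = ⊤ := by
    refine (hirr _ fun s hs u hu => ?_).resolve_left (by simpa using hv)
    rcases hsign s hs with h | h
    · rwa [h]
    · rw [h]; exact Submodule.neg_mem _ hu
  have hmem : ∀ w, ∃ c : ℚ, c • v = w := fun w =>
    Submodule.mem_span_singleton.mp (htop ▸ Submodule.mem_top)
  obtain ⟨c, hc⟩ := hmem (F v)
  have hFw : ∀ w, F w = c • w := by
    intro w
    obtain ⟨d, rfl⟩ := hmem w
    rw [map_smul, ← hc, smul_comm]
  have hc0 : c ≠ 0 := by
    rintro rfl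
    rw [zero_smul] at hc
    exact hv (F.map_eq_zero_iff.mp hc.symm)
  have hFw' : ∀ w, F⁻¹ w = c⁻¹ • w := by
    intro w
    apply F.injective
    rw [hFw, hFw, smul_smul, mul_inv_cancel₀ hc0, one_smul, ← hFw]
    exact F.apply_symm_apply w
  have hL : L ≠ ⊥ := by
    obtain ⟨k, hk, hkv⟩ := hfull v
    rw [Submodule.ne_bot_iff]
    refine ⟨k • v, hkv, ?_⟩
    rw [← Int.cast_smul_eq_zsmul ℚ]
    exact smul_ne_zero (by exact_mod_cast hk) hv
  have hint : IsIntegral ℤ c := isIntegral_of_smul_mem_submodule L hL hfg c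
    fun n hn => by rw [← hFw]; exact hF n hn
  have hint' : IsIntegral ℤ c⁻¹ := isIntegral_of_smul_mem_submodule L hL hfg c⁻¹
    fun n hn => by rw [← hFw']; exact hF' n hn
  rcases Rat.eq_one_or_neg_one_of_isIntegral hc0 hint hint' with rfl | rfl
  · exact ⟨1, S.one_mem, v, hv, by simp [hFw]⟩
  · obtain ⟨s, hs, hs1⟩ := S.bot_or_exists_ne_one.resolve_left hS
    refine ⟨s, hs, v, hv, ?_⟩
    rcases hsign s hs with h | h
    · exact absurd (LinearEquiv.ext h) hs1
    · rw [h, hFw]; simp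

/-- Let `S` be a finite solvable group acting non-trivially and irreducibly on a rational vector
space of odd dimension, and let `F` normalize `S`. If `S`, `F` and `F⁻¹` preserve a lattice, then
some element of the coset `S F` has a non-zero fixed vector. -/
theorem exists_fixed_vector {V : Type*} [AddCommGroup V] [Module ℚ V] [FiniteDimensional ℚ V]
    (S : Subgroup (V ≃ₗ[ℚ] V)) [Finite S] [Group.IsSolvable S] (hirr : ActsIrreducibly S)
    (hS : S ≠ ⊥) (hodd : Odd (finrank ℚ V)) (F : V ≃ₗ[ℚ] V)
    (hFS : ∀ s ∈ S, F * s * F⁻¹ ∈ S) (hFS' : ∀ s ∈ S, F⁻¹ * s * F ∈ S)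
    (L : Submodule ℤ V) (hfg : L.FG) (hfull : ∀ v : V, ∃ k : ℤ, k ≠ 0 ∧ k • v ∈ L)
    (hSL : ∀ s ∈ S, ∀ l ∈ L, s l ∈ L) (hF : ∀ l ∈ L, F l ∈ L) (hF' : ∀ l ∈ L, F⁻¹ l ∈ L) :
    ∃ s ∈ S, ∃ v ≠ 0, s (F v) = v := by
  induction hd : finrank ℚ V using Nat.strong_induction_on generalizing V with
  | _ d ih =>
  by_cases hsign : ∀ s ∈ S, IsSignScalar s
  · have : Nontrivial V := nontrivial_of_finrank_pos (R := ℚ) hodd.pos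
    exact exists_fixed_vector_of_isSignScalar S hirr hS hsign F L hfg hfull hF hF'
  obtain ⟨A, hAS, hcomm, hAsign, hAconj⟩ :=
    exists_commutative_subgroup_not_isSignScalar S hodd hsign
  have : Finite A := Finite.of_injective _ (Subgroup.inclusion_injective hAS)
  have hSconj : ∀ t ∈ S, ∀ s ∈ S, t * s * t⁻¹ ∈ S := fun t ht s hs =>
    S.mul_mem (S.mul_mem ht hs) (S.inv_mem ht)
  have hSconj' : ∀ t ∈ S, ∀ s ∈ S, t⁻¹ * s * t ∈ S := fun t ht s hs =>
    S.mul_mem (S.mul_mem (S.inv_mem ht) hs) ht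
  have hAconj' : ∀ g : V ≃ₗ[ℚ] V, (∀ s ∈ S, g * s * g⁻¹ ∈ S) → (∀ s ∈ S, g⁻¹ * s * g ∈ S) →
      ∀ a ∈ A, g⁻¹ * a * g ∈ A := by
    intro g hg hg' a ha
    have := hAconj g⁻¹ (by simpa using hg') (by simpa using hg) a ha
    simpa using this
  have hblock : ∀ g : V ≃ₗ[ℚ] V, (∀ s ∈ S, g * s * g⁻¹ ∈ S) → (∀ s ∈ S, g⁻¹ * s * g ∈ S) →
      ∀ W ∈ signBlocks A, W.map (g : V →ₗ[ℚ] V) ∈ signBlocks A := fun g hg hg' W hW =>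
    map_mem_signBlocks (hAconj g hg hg') (hAconj' g hg hg') hW
  have hind := sSupIndep_signBlocks hcomm
  have hbot : ⊥ ∉ signBlocks A := fun h => h.1 rfl
  have hmap : ∀ s ∈ S, ∀ W ∈ signBlocks A, W.map (s : V →ₗ[ℚ] V) ∈ signBlocks A :=
    fun s hs => hblock s (hSconj s hs) (hSconj' s hs)
  obtain ⟨W, hW⟩ := signBlocks_nonempty hcomm hodd
  -- `F` moves the block `W` to a block `s W`, so `s⁻¹ F` stabilizes `W`, lies in the same coset of
  -- the normalized group `S`, and still preserves the lattice.
  obtain ⟨s, hs, hsW⟩ := hirr.exists_map_eq hind hbot hmap hW (hblock F hFS hFS' W hW)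
  let g : V ≃ₗ[ℚ] V := s⁻¹ * F
  have hg : g ∈ subspaceStabilizer W := by
    rw [mem_subspaceStabilizer]
    change W.map (((s⁻¹ : V ≃ₗ[ℚ] V) : V →ₗ[ℚ] V) ∘ₗ (F : V →ₗ[ℚ] V)) = W
    rw [Submodule.map_comp, ← hsW, ← Submodule.map_comp]
    have : ((s⁻¹ : V ≃ₗ[ℚ] V) : V →ₗ[ℚ] V) ∘ₗ (s : V →ₗ[ℚ] V) = LinearMap.id := by
      ext v
      exact s.symm_apply_apply v
    rw [this, Submodule.map_id]
  have hgS : ∀ t ∈ S, g * t * g⁻¹ ∈ S := by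
    intro t ht
    have := hSconj' s hs _ (hFS t ht)
    simpa [g, mul_assoc] using this
  have hgS' : ∀ t ∈ S, g⁻¹ * t * g ∈ S := by
    intro t ht
    have := hFS' _ (hSconj s hs t ht)
    simpa [g, mul_assoc] using this
  have hgL : ∀ l ∈ L, g l ∈ L := fun l hl => hSL _ (S.inv_mem hs) _ (hF l hl)
  have hgL' : ∀ l ∈ L, g⁻¹ l ∈ L := by
    intro l hl
    have := hF' _ (hSL s hs l hl)
    rw [show g⁻¹ = F⁻¹ * s by simp [g]]
    exact this
  -- If `W` were all of `V`, every element of `A` would be a sign scalar; so the dimension drops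
  -- strictly.
  have hWtop : W ≠ ⊤ := by
    rintro rfl
    exact hAsign fun a ha => (signBlocks_apply hW ha).imp (fun h v => h v trivial)
      fun h v => h v trivial
  have hlt : finrank ℚ W < d := hd ▸ Submodule.finrank_lt hWtop
  have hWodd : Odd (finrank ℚ W) := hodd.of_dvd_nat (hirr.finrank_dvd hind hbot hmap hW)
  have hAW : ∀ a ∈ A, a ∈ subspaceStabilizer W := by
    intro a ha
    rw [mem_subspaceStabilizer]
    apply le_antisymm
    · rintro _ ⟨w, hw, rfl⟩
      rcases signBlocks_apply hW ha with h | h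
      · exact (h w hw).symm ▸ hw
      · exact (h w hw).symm ▸ W.neg_mem hw
    · intro w hw
      rcases signBlocks_apply hW ha with h | h
      · exact ⟨w, hw, h w hw⟩
      · exact ⟨-w, W.neg_mem hw, by simpa using congrArg Neg.neg (h w hw)⟩
  have hSW : inducedGroup S W ≠ ⊥ := by
    intro hbotW
    have hfix : ∀ a ∈ A, ∀ w ∈ W, a w = w := by
      intro a ha w hw
      have h1 : restrictToSubspace W ⟨a, hAW a ha⟩ ∈ inducedGroup S W :=
        mem_inducedGroup.mpr ⟨⟨a, hAW a ha⟩, hAS ha, rfl⟩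
      rw [hbotW, Subgroup.mem_bot] at h1
      exact congrArg Subtype.val (LinearEquiv.congr_fun h1 ⟨w, hw⟩)
    -- The fixed space of `A` is `S`-invariant since `S` normalizes `A`. If it contained `W` it
    -- would be `V`, making `A` trivial.
    let U : Submodule ℚ V := ⨅ a : A, LinearMap.eqLocus ((a : V ≃ₗ[ℚ] V) : V →ₗ[ℚ] V) LinearMap.id
    have hU : ∀ v, v ∈ U ↔ ∀ a ∈ A, a v = v := by
      intro v
      simp [U, Submodule.mem_iInf]
    have hUtop : U = ⊤ := by
      refine (hirr U fun t ht u hu => ?_).resolve_left ?_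
      · rw [hU] at hu ⊢
        intro a ha
        have h1 := hu _ (hAconj' t (hSconj t ht) (hSconj' t ht) a ha)
        have h2 := congrArg t h1
        simpa [LinearEquiv.mul_apply] using h2
      · intro h
        refine hW.1 (le_bot_iff.mp (h ▸ fun w hw => ?_))
        exact (hU w).mpr fun a ha => hfix a ha w hw
    exact hAsign fun a ha => Or.inl fun v => (hU v).mp (hUtop ▸ Submodule.mem_top) a ha
  let F₁ := restrictToSubspace W ⟨g, hg⟩
  let L₁ : Submodule ℤ W := L.comap (W.subtype.restrictScalars ℤ)
  have hL₁ : L₁.FG := by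
    have : IsNoetherian ℤ L := isNoetherian_of_fg_of_noetherian L hfg
    apply Submodule.fg_of_fg_map_injective (W.subtype.restrictScalars ℤ) W.injective_subtype
    exact Submodule.FG.of_le hfg (Submodule.map_comap_le _ _)
  have hconj₁ : ∀ u ∈ inducedGroup S W, F₁⁻¹ * u * F₁ ∈ inducedGroup S W := by
    intro u hu
    have h1 := conj_mem_inducedGroup (⟨g, hg⟩⁻¹ : subspaceStabilizer W)
      (by simpa only [Subgroup.coe_inv, inv_inv] using hgS') hu
    rwa [map_inv, inv_inv] at h1
  obtain ⟨u, hu, v, hv0, huv⟩ := ih _ hlt (inducedGroup S W) (hirr.inducedGroup hind hmap hW) hSW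
    hWodd F₁ (fun u hu => conj_mem_inducedGroup ⟨g, hg⟩ hgS hu) hconj₁ L₁ hL₁ (by
      intro w
      obtain ⟨k, hk, hkw⟩ := hfull w
      exact ⟨k, hk, hkw⟩) (by
      intro u hu l hl
      obtain ⟨h, hhS, rfl⟩ := mem_inducedGroup.mp hu
      exact hSL _ hhS _ hl) (fun l hl => hgL _ hl) (by
      intro l hl
      have : F₁⁻¹ = restrictToSubspace W ⟨g, hg⟩⁻¹ := (map_inv _ _).symm
      rw [this]
      exact hgL' _ hl) rfl
  obtain ⟨h, hhS, rfl⟩ := mem_inducedGroup.mp hu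
  refine ⟨h * s⁻¹, S.mul_mem hhS (S.inv_mem hs), v, fun h0 => hv0 (Subtype.ext h0), ?_⟩
  exact congrArg Subtype.val huv

/-! ### Realizing automorphisms of the holonomy group by conjugation -/

section Realization

variable {G : Type*} [Group G]

theorem glMap_intCast_injective (m : ℕ) :
    Function.Injective (Matrix.GeneralLinearGroup.map (n := Fin m) (Int.castRingHom ℚ)) := by
  intro A B h
  refine Units.ext (Matrix.map_injective (Int.castRingHom ℚ).injective_int ?_)
  exact congrArg Units.val h

/-- In the faithful case an abstract isomorphism suffices by counting: conjugation embeds `N/C` into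
the automorphisms of the image of `G`, a finite group of the same order, so the embedding is onto.
-/
theorem NormalizerRealizesAut.exists_conj [Finite G] {m : ℕ} {ρ : G →* GL (Fin m) ℤ}
    (h : NormalizerRealizesAut ρ) (α : MulAut G) :
    ∃ x : GL (Fin m) ℚ, ∀ g, ratGL ρ (α g) = x * ratGL ρ g * x⁻¹ := by
  obtain ⟨Φ, hinj | hconj⟩ := h
  · have hr : Function.Injective (ratGL ρ) :=
      (glMap_intCast_injective m).comp hinj
    let H := (ratGL ρ).range
    let e : G ≃* H := MonoidHom.ofInjective hr
    have he : ∀ g, (e g : GL (Fin m) ℚ) = ratGL ρ g := fun g => rfl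
    let c : NormalizerModCentralizer ρ →* MulAut H :=
      QuotientGroup.lift _ H.normalizerMonoidHom (by
        rw [← Subgroup.normalizerMonoidHom_ker])
    have hc : Function.Injective c := by
      rw [injective_iff_map_eq_one]
      intro y hy
      obtain ⟨x, rfl⟩ := QuotientGroup.mk_surjective y
      rw [QuotientGroup.eq_one_iff, ← Subgroup.normalizerMonoidHom_ker]
      exact hy
    have : Finite H := Finite.of_equiv G e.toEquiv
    have : Finite (MulAut G) := Finite.of_injective (fun a : MulAut G => a.toEquiv)
      fun a b hab => MulEquiv.ext fun g => Equiv.congr_fun hab g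
    have : Finite (MulAut H) := Finite.of_injective (fun a : MulAut H => a.toEquiv)
      fun a b hab => MulEquiv.ext fun g => Equiv.congr_fun hab g
    have : Finite (NormalizerModCentralizer ρ) := Finite.of_equiv _ Φ.symm.toEquiv
    have hsurj : Function.Surjective c :=
      (Finite.injective_iff_surjective_of_equiv
        (Φ.toEquiv.trans (MulAut.congr e).toEquiv)).mp hc
    obtain ⟨y, hy⟩ := hsurj (MulAut.congr e α)
    obtain ⟨x, rfl⟩ := QuotientGroup.mk_surjective y
    refine ⟨x, fun g => ?_⟩
    have h1 := congrArg (fun f : MulAut H => ((f (e g) : H) : GL (Fin m) ℚ)) hy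
    have h2 : ((c (QuotientGroup.mk x) (e g) : H) : GL (Fin m) ℚ) =
        x * ratGL ρ g * (x : GL (Fin m) ℚ)⁻¹ := rfl
    have h3 : ((MulAut.congr e α (e g) : H) : GL (Fin m) ℚ) = ratGL ρ (α g) := by
      rw [← he]
      simp [MulAut.congr]
    rw [← h3, ← h2]
    exact h1.symm
  · obtain ⟨x, hx⟩ := QuotientGroup.mk_surjective (Φ.symm α)
    refine ⟨x, fun g => ?_⟩
    rw [← hconj x g, hx, Φ.apply_symm_apply]

end Realization

/-! ### Integral matrices and the standard lattice -/

section IntegralMatrices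

/-- An invertible integral matrix as an automorphism of `ℚⁿ`. -/
def ratAut (n : ℕ) : GL (Fin n) ℤ →* ((Fin n → ℚ) ≃ₗ[ℚ] (Fin n → ℚ)) :=
  (LinearMap.GeneralLinearGroup.generalLinearEquiv ℚ (Fin n → ℚ)).toMonoidHom.comp
    ((Matrix.GeneralLinearGroup.toLin (R := ℚ) (n := Fin n)).toMonoidHom.comp
      (Matrix.GeneralLinearGroup.map (Int.castRingHom ℚ)))

theorem ratAut_apply {n : ℕ} (A : GL (Fin n) ℤ) (v : Fin n → ℚ) :
    ratAut n A v = Matrix.mulVec (A.val.map (Int.castRingHom ℚ)) v := rfl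

/-- The lattice `ℤⁿ` in `ℚⁿ`. -/
def intLattice (n : ℕ) : Submodule ℤ (Fin n → ℚ) :=
  LinearMap.range ((Int.castAddHom ℚ).toIntLinearMap.compLeft (Fin n))

theorem mem_intLattice {n : ℕ} {v : Fin n → ℚ} :
    v ∈ intLattice n ↔ ∃ z : Fin n → ℤ, ∀ i, (z i : ℚ) = v i := by
  constructor
  · rintro ⟨z, rfl⟩
    exact ⟨z, fun i => rfl⟩
  · rintro ⟨z, hz⟩
    exact ⟨z, funext hz⟩

theorem intLattice_fg (n : ℕ) : (intLattice n).FG := by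
  rw [intLattice, LinearMap.range_eq_map]
  exact Module.Finite.fg_top.map _

theorem exists_smul_mem_intLattice {n : ℕ} (v : Fin n → ℚ) :
    ∃ k : ℤ, k ≠ 0 ∧ k • v ∈ intLattice n := by
  refine ⟨∏ i, ((v i).den : ℤ), Finset.prod_ne_zero_iff.mpr fun i _ => by simp, ?_⟩
  rw [mem_intLattice]
  have h : ∀ i, ∃ z : ℤ, (z : ℚ) = ((∏ j, ((v j).den : ℤ)) • v) i := by
    intro i
    obtain ⟨c, hc⟩ := Finset.dvd_prod_of_mem (fun j => ((v j).den : ℤ)) (Finset.mem_univ i)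
    refine ⟨c * (v i).num, ?_⟩
    rw [Pi.smul_apply, hc, zsmul_eq_mul]
    push_cast
    rw [mul_comm ((v i).den : ℚ), mul_assoc, Rat.den_mul_eq_num]
  choose z hz using h
  exact ⟨z, hz⟩

theorem ratAut_mem_intLattice {n : ℕ} (A : GL (Fin n) ℤ) {v : Fin n → ℚ}
    (hv : v ∈ intLattice n) : ratAut n A v ∈ intLattice n := by
  obtain ⟨z, hz⟩ := mem_intLattice.mp hv
  refine mem_intLattice.mpr ⟨Matrix.mulVec A.val z, fun i => ?_⟩
  simp [ratAut_apply, Matrix.mulVec, dotProduct, ← hz]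

end IntegralMatrices

/-! ### Multiplicity one and the invariant constituent -/

section Multiplicity

variable {G k V W : Type*} [Group G] [Field k] [AddCommGroup V] [Module k V] [AddCommGroup W]
  [Module k W] {σ : Representation k G V} {τ : Representation k G W}

theorem isSubrep_of_injective (f : V →ₗ[k] W) (hf : Function.Injective f)
    (hequiv : ∀ g v, f (σ g v) = τ g (f v)) : IsSubrep σ τ := by
  refine ⟨⟨LinearMap.range f, ?_⟩, ⟨Representation.Equiv.mk (LinearEquiv.ofInjective f hf) ?_⟩⟩
  · rintro g _ ⟨v, rfl⟩
    exact ⟨σ g v, hequiv g v⟩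
  · intro g
    ext v
    exact hequiv g v

theorem IsSubrep.exists_injective (h : IsSubrep σ τ) : ∃ f : V →ₗ[k] W, Function.Injective f ∧
    ∀ g v, f (σ g v) = τ g (f v) := by
  obtain ⟨U, ⟨e⟩⟩ := h
  refine ⟨U.toSubmodule.subtype ∘ₗ e.toLinearEquiv.toLinearMap,
    U.toSubmodule.injective_subtype.comp e.toLinearEquiv.injective, fun g v => ?_⟩
  have h1 : e.toLinearEquiv (σ g v) = U.toRepresentation g (e.toLinearEquiv v) :=
    LinearMap.congr_fun (e.isIntertwining' g) v
  exact congrArg Subtype.val h1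

theorem submodule_eq_bot_or_top_of_isIrreducible (hirr : σ.IsIrreducible) (U : Submodule k V)
    (hU : ∀ g, ∀ u ∈ U, σ g u ∈ U) : U = ⊥ ∨ U = ⊤ := by
  have h := hirr.eq_bot_or_eq_top ⟨U, fun g u hu => hU g u hu⟩
  rcases h with h | h
  · left
    exact congrArg Subrepresentation.toSubmodule h
  · right
    exact congrArg Subrepresentation.toSubmodule h

/-- If an irreducible representation has multiplicity one, then its image under an equivariant
embedding does not depend on the embedding. -/
theorem range_eq_of_repMultiplicity_eq_one [FiniteDimensional k V] [FiniteDimensional k W]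
    (hirr : σ.IsIrreducible)
    (hmult : repMultiplicity σ τ = 1) {f f' : V →ₗ[k] W} (hf : Function.Injective f)
    (hf' : Function.Injective f') (hfσ : ∀ g v, f (σ g v) = τ g (f v))
    (hfσ' : ∀ g v, f' (σ g v) = τ g (f' v)) : LinearMap.range f' = LinearMap.range f := by
  rcases submodule_eq_bot_or_top_of_isIrreducible hirr ((LinearMap.range f).comap f') (by
    rintro g u ⟨v, hv⟩
    exact ⟨σ g v, by rw [hfσ, hfσ', hv]⟩) with h | h
  · exfalso
    -- If the two images meet trivially, `f` and `f'` together embed two copies of `σ`.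
    let F : (DirectSum (Fin 2) fun _ => V) →ₗ[k] W := DirectSum.toModule k (Fin 2) W ![f, f']
    have hF : ∀ x, F x = f (x 0) + f' (x 1) := by
      intro x
      have : F = f ∘ₗ DirectSum.component k (Fin 2) (fun _ => V) 0 +
          f' ∘ₗ DirectSum.component k (Fin 2) (fun _ => V) 1 := by
        refine DirectSum.linearMap_ext _ fun i => ?_
        ext v
        fin_cases i <;> simp [F, DirectSum.component.of, DirectSum.toModule_lof]
      rw [this]
      rfl
    have h2 : IsSubrep (Representation.directSum (fun _ : Fin 2 => σ)) τ := by
      refine isSubrep_of_injective F ?_ ?_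
      · rw [injective_iff_map_eq_zero]
        intro x hx
        rw [hF] at hx
        have h1 : x 1 ∈ (LinearMap.range f).comap f' :=
          ⟨-x 0, by rw [map_neg]; exact neg_eq_of_add_eq_zero_right hx⟩
        rw [h, Submodule.mem_bot] at h1
        rw [h1, map_zero f', add_zero] at hx
        have h0 := (injective_iff_map_eq_zero f).mp hf _ hx
        refine DFinsupp.ext fun i => ?_
        fin_cases i
        · exact h0
        · exact h1
      · intro g x
        rw [hF, hF, map_add, ← hfσ, ← hfσ']
        rfl
    -- An unbounded set of naturals has `sSup` equal to `0`, so multiplicity `1` already implies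
    -- boundedness.
    have hbdd : BddAbove
        {r : ℕ | IsSubrep (Representation.directSum (fun _ : Fin r => σ)) τ} := by
      by_contra hb
      rw [repMultiplicity, Nat.sSup_of_not_bddAbove hb] at hmult
      exact zero_ne_one hmult
    have hle := le_csSup hbdd h2
    rw [repMultiplicity] at hmult
    rw [hmult] at hle
    omega
  · have hle : LinearMap.range f' ≤ LinearMap.range f := by
      rintro _ ⟨v, rfl⟩
      have : v ∈ (LinearMap.range f).comap f' := h ▸ Submodule.mem_top
      exact this
    refine Submodule.eq_of_le_of_finrank_eq hle ?_
    rw [LinearMap.finrank_range_of_inj hf, LinearMap.finrank_range_of_inj hf']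

end Multiplicity

/-- Suppose that an odd-dimensional irreducible constituent of multiplicity one of an integral
representation `ρ` of a finite solvable group is non-trivial and isomorphic to its twist by `α`,
and that `M` intertwines `ρ` and its twist by `α`. Then `ρ(g) M` has the eigenvalue `1` for
some `g`. -/
theorem exists_fixed_vector_of_intertwining {G : Type*} [Group G] [Finite G] [Group.IsSolvable G]
    {n m : ℕ} (ρ : G →* GL (Fin n) ℤ) (ρ' : G →* GL (Fin m) ℤ)
    (hirr : (ratRep ρ').IsIrreducible) (hsub : IsSubrep (ratRep ρ') (ratRep ρ))
    (hmult : repMultiplicity (ratRep ρ') (ratRep ρ) = 1) (hodd : Odd m) (hnontriv : ρ' ≠ 1)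
    (α : MulAut G) (x : GL (Fin m) ℚ) (hx : ∀ g, ratGL ρ' (α g) = x * ratGL ρ' g * x⁻¹)
    (M : GL (Fin n) ℤ) (hM : ∀ g, M * ρ g = ρ (α g) * M) :
    ∃ g, ∃ u ≠ 0, ratAut n (ρ g * M) u = u := by
  obtain ⟨f, hf, hfρ⟩ := hsub.exists_injective
  let r : G →* ((Fin n → ℚ) ≃ₗ[ℚ] (Fin n → ℚ)) := (ratAut n).comp ρ
  have hr : ∀ g v, f (ratRep ρ' g v) = r g (f v) := hfρ
  let F := ratAut n M
  have hFr : ∀ g v, F (r g v) = r (α g) (F v) := by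
    intro g v
    have h := congrArg (ratAut n) (hM g)
    rw [map_mul, map_mul] at h
    exact LinearEquiv.congr_fun h v
  let W := LinearMap.range f
  have hrW : ∀ g, r g ∈ subspaceStabilizer W := by
    intro g
    rw [mem_subspaceStabilizer]
    apply le_antisymm
    · rintro _ ⟨_, ⟨v, rfl⟩, rfl⟩
      exact ⟨_, hr g v⟩
    · rintro _ ⟨v, rfl⟩
      refine ⟨r g⁻¹ (f v), ⟨_, hr g⁻¹ v⟩, ?_⟩
      have : (r g * r g⁻¹) (f v) = f v := by rw [← map_mul, mul_inv_cancel, map_one]; rfl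
      exact this
  have hFW : F ∈ subspaceStabilizer W := by
    rw [mem_subspaceStabilizer]
    let X : (Fin m → ℚ) →ₗ[ℚ] (Fin m → ℚ) := Matrix.mulVecLin (x⁻¹ : GL (Fin m) ℚ).val
    let Y : (Fin m → ℚ) →ₗ[ℚ] (Fin m → ℚ) := Matrix.mulVecLin x.val
    have hYX : ∀ v, Y (X v) = v := by
      intro v
      simp only [X, Y, Matrix.mulVecLin_apply, Matrix.mulVec_mulVec]
      rw [← Units.val_mul, mul_inv_cancel, Units.val_one, Matrix.one_mulVec]
    have hXY : ∀ v, X (Y v) = v := by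
      intro v
      simp only [X, Y, Matrix.mulVecLin_apply, Matrix.mulVec_mulVec]
      rw [← Units.val_mul, inv_mul_cancel, Units.val_one, Matrix.one_mulVec]
    have hXinj : Function.Injective X := Function.LeftInverse.injective hYX
    have hρ'v : ∀ g v, ratRep ρ' g v = Matrix.mulVec (ratGL ρ' g).val v := fun g v => rfl
    have hXρ : ∀ g v, X (ratRep ρ' (α g) v) = ratRep ρ' g (X v) := by
      intro g v
      rw [hρ'v, hρ'v, hx]
      simp only [X, Matrix.mulVecLin_apply, Matrix.mulVec_mulVec]
      rw [← Units.val_mul, ← Units.val_mul]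
      congr 2
      group
    -- `F` twists `ρ` by `α` and `x⁻¹` twists `ρ'` by `α⁻¹`. The twists cancel, so `F f x⁻¹` is an
    -- equivariant embedding with image `F W`, which must be `W`.
    let f' : (Fin m → ℚ) →ₗ[ℚ] (Fin n → ℚ) := F.toLinearMap ∘ₗ f ∘ₗ X
    have hf' : Function.Injective f' := F.injective.comp (hf.comp hXinj)
    have hfρ' : ∀ g v, f' (ratRep ρ' g v) = ratRep ρ g (f' v) := by
      intro g v
      have h := hXρ (α.symm g) v
      rw [MulEquiv.apply_symm_apply] at h
      change F (f (X (ratRep ρ' g v))) = r g (F (f (X v)))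
      rw [h, hr, hFr, MulEquiv.apply_symm_apply]
    have hrange := range_eq_of_repMultiplicity_eq_one hirr hmult hf hf' hfρ hfρ'
    apply le_antisymm
    · rintro _ ⟨_, ⟨v, rfl⟩, rfl⟩
      have h : F (f v) ∈ LinearMap.range f' :=
        ⟨Y v, by change F (f (X (Y v))) = F (f v); rw [hXY]⟩
      rwa [hrange] at h
    · intro w hw
      have h : w ∈ LinearMap.range f' := by rwa [hrange]
      obtain ⟨v, rfl⟩ := h
      exact ⟨f (X v), ⟨_, rfl⟩, rfl⟩
  let R := r.range
  have : Finite R := Set.finite_range r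
  have : Group.IsSolvable R := Group.isSolvable_of_surjective r.rangeRestrict_surjective
  have hFR : ∀ s ∈ R, F * s * F⁻¹ ∈ R := by
    rintro _ ⟨g, rfl⟩
    refine ⟨α g, ?_⟩
    rw [eq_mul_inv_iff_mul_eq]
    ext1 v
    exact (hFr g v).symm
  have hFR' : ∀ s ∈ R, F⁻¹ * s * F ∈ R := by
    rintro _ ⟨g, rfl⟩
    refine ⟨α.symm g, ?_⟩
    rw [mul_assoc, eq_inv_mul_iff_mul_eq]
    ext1 v
    have := hFr (α.symm g) v
    rwa [MulEquiv.apply_symm_apply] at this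
  have hind : ∀ g, restrictToSubspace W ⟨r g, hrW g⟩ ∈ inducedGroup R W := fun g =>
    mem_inducedGroup.mpr ⟨⟨r g, hrW g⟩, ⟨g, rfl⟩, rfl⟩
  have hirrW : ActsIrreducibly (inducedGroup R W) := by
    intro U hU
    let e : (Fin m → ℚ) ≃ₗ[ℚ] W := LinearEquiv.ofInjective f hf
    have he : ∀ g v, e (ratRep ρ' g v) = restrictToSubspace W ⟨r g, hrW g⟩ (e v) := fun g v =>
      Subtype.ext (hr g v)
    have h := submodule_eq_bot_or_top_of_isIrreducible hirr (U.comap e.toLinearMap) (by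
      intro g u hu
      change e (ratRep ρ' g u) ∈ U
      rw [he]
      exact hU _ (hind g) _ hu)
    refine h.imp (fun h => ?_) fun h => ?_
    · rw [eq_bot_iff]
      intro w hw
      have h1 : e.symm w ∈ U.comap e.toLinearMap := by
        change e (e.symm w) ∈ U
        rwa [e.apply_symm_apply]
      rw [h, Submodule.mem_bot] at h1
      exact e.symm.map_eq_zero_iff.mp h1
    · rw [eq_top_iff]
      intro w _
      have h1 : e.symm w ∈ U.comap e.toLinearMap := h ▸ Submodule.mem_top
      have h2 : e (e.symm w) ∈ U := h1
      rwa [e.apply_symm_apply] at h2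
  have hnontrivW : inducedGroup R W ≠ ⊥ := by
    intro hbot
    refine hnontriv (MonoidHom.ext fun g => glMap_intCast_injective m ?_)
    have h1 := hind g
    rw [hbot, Subgroup.mem_bot] at h1
    have h2 : ∀ v, r g (f v) = f v := fun v =>
      congrArg Subtype.val (LinearEquiv.congr_fun h1 ⟨f v, v, rfl⟩)
    refine Units.ext (Matrix.mulVec_injective (funext fun v => ?_))
    have h3 : ratRep ρ' g v = v := hf (by rw [hr, h2])
    refine Eq.trans h3 ?_
    simp
  have hoddW : Odd (finrank ℚ W) := by
    rw [LinearMap.finrank_range_of_inj hf, finrank_fin_fun]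
    exact hodd
  let L : Submodule ℤ W := (intLattice n).comap (W.subtype.restrictScalars ℤ)
  have hL : L.FG := by
    have : IsNoetherian ℤ (intLattice n) := isNoetherian_of_fg_of_noetherian _ (intLattice_fg n)
    apply Submodule.fg_of_fg_map_injective (W.subtype.restrictScalars ℤ) W.injective_subtype
    exact Submodule.FG.of_le (intLattice_fg n) (Submodule.map_comap_le _ _)
  let F₁ := restrictToSubspace W ⟨F, hFW⟩
  have hF₁ : F₁⁻¹ = restrictToSubspace W ⟨F, hFW⟩⁻¹ := (map_inv _ _).symm
  have hconj : ∀ u ∈ inducedGroup R W, F₁⁻¹ * u * F₁ ∈ inducedGroup R W := by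
    intro u hu
    have h1 := conj_mem_inducedGroup (⟨F, hFW⟩⁻¹ : subspaceStabilizer W)
      (by simpa only [Subgroup.coe_inv, inv_inv] using hFR') hu
    rwa [map_inv, inv_inv] at h1
  obtain ⟨u, hu, w, hw0, huw⟩ := exists_fixed_vector (inducedGroup R W) hirrW hnontrivW hoddW F₁
    (fun u hu => conj_mem_inducedGroup ⟨F, hFW⟩ hFR hu) hconj L hL
    (fun w => exists_smul_mem_intLattice (w : Fin n → ℚ)) (by
      intro u hu l hl
      obtain ⟨h, ⟨g, hg⟩, rfl⟩ := mem_inducedGroup.mp hu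
      change (h : (Fin n → ℚ) ≃ₗ[ℚ] (Fin n → ℚ)) l ∈ intLattice n
      rw [← hg]
      exact ratAut_mem_intLattice (ρ g) hl)
    (fun l hl => ratAut_mem_intLattice M hl) (by
      intro l hl
      rw [hF₁]
      change (F⁻¹ : (Fin n → ℚ) ≃ₗ[ℚ] (Fin n → ℚ)) l ∈ intLattice n
      rw [← map_inv]
      exact ratAut_mem_intLattice M⁻¹ hl)
  obtain ⟨h, ⟨g, hg⟩, rfl⟩ := mem_inducedGroup.mp hu
  refine ⟨g, w, fun h0 => hw0 (Subtype.ext h0), ?_⟩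
  have h1 : (h : (Fin n → ℚ) ≃ₗ[ℚ] (Fin n → ℚ)) (F w) = w := congrArg Subtype.val huw
  rw [← hg] at h1
  rw [map_mul]
  exact h1

/-! ### Euclidean isometries and translations -/

section Isometries

variable {n : ℕ}

theorem eucIsom_apply (γ : EucIsom n) (x : Euc n) : γ x = linearPart n γ x + γ 0 := by
  have h : γ x = γ (x + 0) := by rw [add_zero]
  exact h.trans (γ.map_vadd 0 x)

theorem translation_apply (v x : Euc n) : translation v x = v + x := rfl

theorem translation_injective : Function.Injective (translation : Euc n → EucIsom n) := by
  intro v w h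
  have := congrArg (fun γ : EucIsom n => γ 0) h
  simpa [translation_apply] using this

theorem translation_add (v w : Euc n) : translation (v + w) = translation v * translation w := by
  ext1 x
  exact add_assoc v w x

theorem linearPart_translation (v : Euc n) : linearPart n (translation v) = 1 := by
  ext1 x
  have h := eucIsom_apply (translation v) x
  rw [translation_apply, translation_apply, add_zero, add_comm] at h
  exact (add_right_cancel h).symm

theorem eq_translation_of_linearPart_eq_one {γ : EucIsom n} (h : linearPart n γ = 1) :
    γ = translation (γ 0) := by
  ext1 x
  rw [eucIsom_apply, h, translation_apply, add_comm]
  rfl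

theorem conj_translation (γ : EucIsom n) (v : Euc n) :
    γ * translation v * γ⁻¹ = translation (linearPart n γ v) := by
  ext1 x
  change γ (v + γ⁻¹ x) = linearPart n γ v + x
  have h1 : γ (γ⁻¹ x) = x := γ.apply_symm_apply x
  rw [eucIsom_apply, map_add, add_assoc, ← eucIsom_apply, h1]

theorem continuous_translation : Continuous (translation : Euc n → EucIsom n) := by
  refine continuous_induced_rng.mpr ?_
  refine Continuous.prodMk ?_ ?_
  · have h : (fun v : Euc n => (((translation v).linearIsometryEquiv.toContinuousLinearEquiv :
        Euc n ≃L[ℝ] Euc n) : Euc n →L[ℝ] Euc n)) = fun _ => ContinuousLinearMap.id ℝ (Euc n) := by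
      funext v
      ext1 x
      exact congrArg (fun A : Euc n ≃ₗᵢ[ℝ] Euc n => A x) (linearPart_translation v)
    rw [h]
    exact continuous_const
  · have h : (fun v : Euc n => translation v 0) = id := by
      funext v
      simp [translation_apply]
    rw [h]
    exact continuous_id

end Isometries

/-! ### The translation lattice and finiteness of the holonomy group -/

section Lattice

variable {n : ℕ} {Γ : Subgroup (EucIsom n)}

theorem discreteTopology_translationLattice (hΓ : DiscreteTopology Γ) :
    DiscreteTopology (translationLattice Γ) := by
  let i : translationLattice Γ → Γ := fun v => ⟨translation (v : Euc n), v.2⟩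
  have hi : Continuous i := (continuous_translation.comp continuous_subtype_val).subtype_mk _
  exact DiscreteTopology.of_continuous_injective hi fun v w h =>
    Subtype.ext (translation_injective (congrArg Subtype.val h))

theorem finite_translationLattice_inter (hΓ : DiscreteTopology Γ) {K : Set (Euc n)}
    (hK : Bornology.IsBounded K) : {v | v ∈ K ∧ v ∈ translationLattice Γ}.Finite := by
  have := discreteTopology_translationLattice hΓ
  exact Metric.finite_isBounded_inter_isClosed (s := (translationLattice Γ : Set (Euc n)))
    DiscreteTopology.isDiscrete hK AddSubgroup.isClosed_of_discrete

/-- For a discrete subgroup the dimension of the real span equals the `ℤ`-rank, which the basis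
shows to be `n`. -/
theorem span_translationLattice_eq_top (hΓ : DiscreteTopology Γ)
    (e : Basis (Fin n) ℤ (translationLattice Γ)) :
    Submodule.span ℝ (translationLattice Γ : Set (Euc n)) = ⊤ := by
  have hd := discreteTopology_translationLattice hΓ
  have hspan : Submodule.span ℤ (translationLattice Γ : Set (Euc n)) =
      AddSubgroup.toIntSubmodule (translationLattice Γ) := by
    rw [← AddSubgroup.toIntSubmodule_closure, AddSubgroup.closure_eq]
  have hd' : DiscreteTopology (Submodule.span ℤ (translationLattice Γ : Set (Euc n))) := by
    rw [hspan]
    exact hd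
  have h := Real.finrank_eq_int_finrank_of_discrete hd'
  apply Submodule.eq_top_of_finrank_eq
  rw [finrank_euclideanSpace_fin]
  refine Eq.trans h ?_
  rw [Set.finrank, hspan]
  exact (finrank_eq_card_basis e).trans (Fintype.card_fin n)

theorem linearPart_mem_translationLattice (γ : Γ) {v : Euc n} (hv : v ∈ translationLattice Γ) :
    linearPart n γ v ∈ translationLattice Γ := by
  change translation _ ∈ Γ
  rw [← conj_translation]
  exact Γ.mul_mem (Γ.mul_mem γ.2 hv) (Γ.inv_mem γ.2)

theorem ext_of_eqOn_translationLattice (hΓ : DiscreteTopology Γ)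
    (e : Basis (Fin n) ℤ (translationLattice Γ)) {A B : Euc n ≃ₗᵢ[ℝ] Euc n}
    (h : ∀ v ∈ translationLattice Γ, A v = B v) : A = B := by
  have h1 : (A.toLinearEquiv : Euc n →ₗ[ℝ] Euc n) = (B.toLinearEquiv : Euc n →ₗ[ℝ] Euc n) :=
    LinearMap.ext_on (span_translationLattice_eq_top hΓ e) h
  ext1 x
  exact LinearMap.congr_fun h1 x

/-- A linear part is determined by the images of the basis vectors, and each image is a lattice
vector in a fixed ball, leaving finitely many choices. -/
theorem finite_holonomyGroup (hΓ : DiscreteTopology Γ)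
    (e : Basis (Fin n) ℤ (translationLattice Γ)) : Finite (HolonomyGroup Γ) := by
  let L := (linearPart n).comp Γ.subtype
  let S : Fin n → Set (Euc n) := fun i =>
    {v | v ∈ Metric.closedBall (0 : Euc n) ‖(e i : Euc n)‖ ∧ v ∈ translationLattice Γ}
  have hS : ∀ i, Finite (S i) := fun i =>
    finite_translationLattice_inter hΓ Metric.isBounded_closedBall
  have hL : ∀ A : L.range, ∀ i, (A : Euc n ≃ₗᵢ[ℝ] Euc n) (e i) ∈ S i := by
    rintro ⟨_, γ, rfl⟩ i
    refine ⟨?_, linearPart_mem_translationLattice γ (e i).2⟩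
    rw [mem_closedBall_zero_iff, LinearIsometryEquiv.norm_map]
  have : Finite L.range := by
    refine Finite.of_injective (fun A : L.range => fun i => (⟨_, hL A i⟩ : S i)) fun A B h => ?_
    refine Subtype.ext (ext_of_eqOn_translationLattice hΓ e fun v hv => ?_)
    have h2 : ∀ i, (A : Euc n ≃ₗᵢ[ℝ] Euc n) (e i) = (B : Euc n ≃ₗᵢ[ℝ] Euc n) (e i) := fun i =>
      congrArg Subtype.val (congrFun h i)
    let f : (Euc n ≃ₗᵢ[ℝ] Euc n) → translationLattice Γ →ₗ[ℤ] Euc n := fun A =>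
      (A.toLinearEquiv.toAddMonoidHom.comp (translationLattice Γ).subtype).toIntLinearMap
    have h3 : f A = f B := e.ext h2
    exact LinearMap.congr_fun h3 ⟨v, hv⟩
  exact Finite.of_equiv _ (QuotientGroup.quotientKerEquivRange L).symm.toEquiv

theorem mem_translationSubgroup {γ : Γ} :
    γ ∈ translationSubgroup Γ ↔ linearPart n (γ : EucIsom n) = 1 := Iff.rfl

theorem zero_mem_translationLattice_of_mem {γ : Γ} (hγ : γ ∈ translationSubgroup Γ) :
    (γ : EucIsom n) 0 ∈ translationLattice Γ := by
  have h : (γ : EucIsom n) = translation ((γ : EucIsom n) 0) :=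
    eq_translation_of_linearPart_eq_one hγ
  change translation _ ∈ Γ
  rw [← h]
  exact γ.2

/-- The translations of `Γ`, as a subgroup and as a lattice. -/
def translationEquiv (Γ : Subgroup (EucIsom n)) :
    translationSubgroup Γ ≃* Multiplicative (translationLattice Γ) where
  toFun γ := .ofAdd ⟨((γ : Γ) : EucIsom n) 0, zero_mem_translationLattice_of_mem γ.2⟩
  invFun v := ⟨⟨translation (v.toAdd : Euc n), v.toAdd.2⟩, linearPart_translation _⟩
  left_inv γ := by
    refine Subtype.ext (Subtype.ext ?_)
    exact (eq_translation_of_linearPart_eq_one γ.2).symm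
  right_inv v := by
    refine congrArg Multiplicative.ofAdd (Subtype.ext ?_)
    exact add_zero _
  map_mul' γ δ := by
    refine congrArg Multiplicative.ofAdd (Subtype.ext ?_)
    have h : ((γ : Γ) : EucIsom n) = translation (((γ : Γ) : EucIsom n) 0) :=
      eq_translation_of_linearPart_eq_one γ.2
    exact congrArg (fun g : EucIsom n => g (((δ : Γ) : EucIsom n) 0)) h

end Lattice

/-! ### The covering of the flat manifold by Euclidean space -/

section Covering

variable {n : ℕ} {Γ : Subgroup (EucIsom n)}

/-- The power of `γ` by the order of the holonomy group is a translation with a fixed point, hence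
trivial; torsion-freeness then applies. -/
theorem eq_one_of_apply_eq [Finite (HolonomyGroup Γ)]
    (htf : ∀ γ ∈ Γ, IsOfFinOrder γ → γ = 1) {γ : EucIsom n} (hγ : γ ∈ Γ) {x : Euc n}
    (hx : γ x = x) : γ = 1 := by
  refine htf γ hγ (isOfFinOrder_iff_pow_eq_one.mpr
    ⟨Nat.card (HolonomyGroup Γ), Nat.card_pos, ?_⟩)
  have h1 : (⟨γ, hγ⟩ : Γ) ^ Nat.card (HolonomyGroup Γ) ∈ translationSubgroup Γ := by
    rw [← QuotientGroup.eq_one_iff, QuotientGroup.mk_pow, pow_card_eq_one']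
  have h2 := eq_translation_of_linearPart_eq_one (mem_translationSubgroup.mp h1)
  rw [Subgroup.coe_pow] at h2
  have h3 : ∀ k : ℕ, (γ ^ k) x = x := by
    intro k
    induction k with
    | zero => rfl
    | succ k ih =>
      rw [pow_succ]
      exact (congrArg (γ ^ k) hx).trans ih
  have h4 := h3 (Nat.card (HolonomyGroup Γ))
  change γ ^ _ = _ at h2
  rw [h2, translation_apply, add_eq_right] at h4
  rw [h2, h4]
  ext1 y
  exact zero_add y

/-- Every element is a lattice translation times one of finitely many coset representatives. For
each representative, meeting both compact sets confines the translation vector to a bounded set,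
which has finitely many lattice points. -/
theorem properlyDiscontinuousSMul_of_finite_holonomyGroup (hΓ : DiscreteTopology Γ)
    [Finite (HolonomyGroup Γ)] : ProperlyDiscontinuousSMul Γ (Euc n) := by
  constructor
  intro K L hK hL
  let T : HolonomyGroup Γ → Set (Euc n) := fun q =>
    {v | v ∈ (fun p : Euc n × Euc n => p.1 - ((q.out : Γ) : EucIsom n) p.2) '' (L ×ˢ K) ∧
      v ∈ translationLattice Γ}
  have hT : ∀ q, (T q).Finite := by
    intro q
    refine finite_translationLattice_inter hΓ (IsCompact.isBounded ?_)
    refine (hL.prod hK).image (continuous_fst.sub ?_)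
    exact (q.out : EucIsom n).continuous.comp continuous_snd
  refine (Set.finite_iUnion fun q => (hT q).image
    fun v => translation v * ((q.out : Γ) : EucIsom n)).preimage
    (f := Subtype.val) Subtype.val_injective.injOn |>.subset ?_
  rintro γ ⟨_, ⟨x, hx, rfl⟩, hy⟩
  let q : HolonomyGroup Γ := QuotientGroup.mk γ
  have hq : γ * (q.out)⁻¹ ∈ translationSubgroup Γ := by
    rw [← QuotientGroup.eq_one_iff, QuotientGroup.mk_mul, QuotientGroup.mk_inv,
      QuotientGroup.out_eq', mul_inv_cancel]
  have h1 := eq_translation_of_linearPart_eq_one (mem_translationSubgroup.mp hq)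
  have h2 := zero_mem_translationLattice_of_mem hq
  set v := ((γ * (q.out)⁻¹ : Γ) : EucIsom n) 0 with hv
  have h3 : (γ : EucIsom n) = translation v * ((q.out : Γ) : EucIsom n) := by
    rw [← h1, Subgroup.coe_mul, Subgroup.coe_inv, inv_mul_cancel_right]
  refine Set.mem_iUnion.mpr ⟨q, v, ⟨⟨((γ : EucIsom n) x, x), ⟨hy, hx⟩, ?_⟩, h2⟩, h3.symm⟩
  have h4 : (γ : EucIsom n) x = v + ((q.out : Γ) : EucIsom n) x :=
    congrArg (fun g : EucIsom n => g x) h3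
  change (γ : EucIsom n) x - ((q.out : Γ) : EucIsom n) x = v
  rw [h4, add_sub_cancel_right]

theorem isQuotientCoveringMap_flatOrbitSpace (hΓ : IsBieberbach Γ) [Finite (HolonomyGroup Γ)] :
    IsQuotientCoveringMap (Quotient.mk (MulAction.orbitRel Γ (Euc n))) Γ := by
  have h1 : ContinuousConstSMul Γ (Euc n) := ⟨fun γ => (γ : EucIsom n).continuous⟩
  have h2 := properlyDiscontinuousSMul_of_finite_holonomyGroup hΓ.discrete
  have h3 : IsCancelSMul Γ (Euc n) := isCancelSMul_iff_eq_one_of_smul_eq.mpr fun γ x hx =>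
    Subtype.ext (eq_one_of_apply_eq hΓ.torsionFree γ.2 hx)
  exact isQuotientCoveringMap_quotientMk_of_properlyDiscontinuousSMul (E := Euc n) (G := Γ)

end Covering

/-! ### Automorphisms of `Γ` acting on the lattice -/

section Automorphisms

variable {n : ℕ} {Γ : Subgroup (EucIsom n)}

/-- An element of the translation lattice, as a translation in `Γ`. -/
def latticeTranslation (v : translationLattice Γ) : Γ := ⟨translation (v : Euc n), v.2⟩

theorem latticeTranslation_injective :
    Function.Injective (latticeTranslation : translationLattice Γ → Γ) := fun _ _ h =>
  Subtype.ext (translation_injective (congrArg Subtype.val h))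

theorem latticeTranslation_add (v w : translationLattice Γ) :
    latticeTranslation (v + w) = latticeTranslation v * latticeTranslation w :=
  Subtype.ext (translation_add (v : Euc n) w)

theorem latticeTranslation_mem (v : translationLattice Γ) :
    latticeTranslation v ∈ translationSubgroup Γ := linearPart_translation _

theorem exists_latticeTranslation_eq {γ : Γ} (hγ : γ ∈ translationSubgroup Γ) :
    ∃ v, latticeTranslation v = γ :=
  ⟨⟨_, zero_mem_translationLattice_of_mem hγ⟩,
    Subtype.ext (eq_translation_of_linearPart_eq_one hγ).symm⟩

/-- The conjugation action of `Γ` on its translation lattice. -/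
def latticeConj (γ : Γ) : translationLattice Γ →ₗ[ℤ] translationLattice Γ :=
  AddMonoidHom.toIntLinearMap
    { toFun := fun v => ⟨linearPart n γ (v : Euc n), linearPart_mem_translationLattice γ v.2⟩
      map_zero' := Subtype.ext (linearPart n (γ : EucIsom n)).map_zero
      map_add' := fun v w => Subtype.ext ((linearPart n (γ : EucIsom n)).map_add v w) }

theorem latticeTranslation_latticeConj (γ : Γ) (v : translationLattice Γ) :
    latticeTranslation (latticeConj γ v) = γ * latticeTranslation v * γ⁻¹ :=
  Subtype.ext (conj_translation (γ : EucIsom n) v).symm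

/-- Every automorphism preserves the subgroup of translations, the translations being the elements
with centralizer of finite index. -/
theorem map_mem_translationSubgroup (hΓ : DiscreteTopology Γ)
    (e : Basis (Fin n) ℤ (translationLattice Γ)) (φ : Γ ≃* Γ) {t : Γ}
    (ht : t ∈ translationSubgroup Γ) : φ t ∈ translationSubgroup Γ := by
  have := finite_holonomyGroup hΓ e
  refine ext_of_eqOn_translationLattice hΓ e fun v hv => ?_
  let τ : Γ := latticeTranslation ⟨v, hv⟩
  let m := Nat.card (HolonomyGroup Γ)
  have hm : m ≠ 0 := Nat.card_pos.ne'
  -- The `m`-th power pushes `φ⁻¹ τ` into the abelian group of translations, where it commutes with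
  -- `t`. Applying `φ`, `φ t` commutes with translation by `m v`, so its linear part fixes `m v` and
  -- hence `v`.
  have hτ : φ.symm τ ^ m ∈ translationSubgroup Γ := by
    rw [← QuotientGroup.eq_one_iff, QuotientGroup.mk_pow, pow_card_eq_one']
  have hcomm : φ t * τ ^ m = τ ^ m * φ t := by
    obtain ⟨a, ha⟩ := exists_latticeTranslation_eq ht
    obtain ⟨b, hb⟩ := exists_latticeTranslation_eq hτ
    have h : t * φ.symm τ ^ m = φ.symm τ ^ m * t := by
      rw [← ha, ← hb, ← latticeTranslation_add, ← latticeTranslation_add, add_comm]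
    have h2 := congrArg φ h
    simpa using h2
  have hpow : ∀ k : ℕ, τ ^ k = latticeTranslation (k • (⟨v, hv⟩ : translationLattice Γ)) := by
    intro k
    induction k with
    | zero =>
      rw [pow_zero, zero_smul]
      refine Subtype.ext ?_
      ext1 x
      exact (zero_add x).symm
    | succ k ih => rw [pow_succ, ih, succ_nsmul, latticeTranslation_add]
  rw [hpow] at hcomm
  have h1 : latticeConj (φ t) (m • (⟨v, hv⟩ : translationLattice Γ)) = m • ⟨v, hv⟩ := by
    apply latticeTranslation_injective
    rw [latticeTranslation_latticeConj, hcomm, mul_inv_cancel_right]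
  rw [map_nsmul] at h1
  have h2 : m • linearPart n (φ t : EucIsom n) v = m • v := congrArg Subtype.val h1
  rw [← Nat.cast_smul_eq_nsmul ℝ, ← Nat.cast_smul_eq_nsmul ℝ] at h2
  exact smul_right_injective _ (by exact_mod_cast hm : (m : ℝ) ≠ 0) h2

/-- The map induced on the translation lattice by an endomorphism preserving translations. -/
def latticeMap (φ : Γ →* Γ) (hφ : ∀ t ∈ translationSubgroup Γ, φ t ∈ translationSubgroup Γ) :
    translationLattice Γ →ₗ[ℤ] translationLattice Γ :=
  AddMonoidHom.toIntLinearMap <| AddMonoidHom.mk'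
    (fun v => (exists_latticeTranslation_eq (hφ _ (latticeTranslation_mem v))).choose) <| by
      intro v w
      have h := fun v =>
        (exists_latticeTranslation_eq (hφ _ (latticeTranslation_mem v))).choose_spec
      apply latticeTranslation_injective
      refine (h (v + w)).trans ?_
      rw [latticeTranslation_add v w, map_mul, latticeTranslation_add]
      exact congrArg₂ (· * ·) (h v).symm (h w).symm

theorem latticeTranslation_latticeMap (φ : Γ →* Γ)
    (hφ : ∀ t ∈ translationSubgroup Γ, φ t ∈ translationSubgroup Γ) (v : translationLattice Γ) :
    latticeTranslation (latticeMap φ hφ v) = φ (latticeTranslation v) :=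
  (exists_latticeTranslation_eq (hφ _ (latticeTranslation_mem v))).choose_spec

theorem toMatrix_latticeConj (e : Basis (Fin n) ℤ (translationLattice Γ))
    {ρ : HolonomyGroup Γ →* GL (Fin n) ℤ}
    (he : ∀ (γ : Γ) (j : Fin n), (γ : EucIsom n) * translation (e j : Euc n) * (γ : EucIsom n)⁻¹ =
      translation ((∑ i, (ρ (QuotientGroup.mk γ)).val i j • e i : translationLattice Γ) : Euc n))
    (γ : Γ) : LinearMap.toMatrix e e (latticeConj γ) = (ρ (QuotientGroup.mk γ)).val := by
  rw [← LinearMap.toMatrix_toLin e e (ρ (QuotientGroup.mk γ)).val]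
  congr 1
  refine e.ext fun j => ?_
  rw [Matrix.toLin_self]
  apply latticeTranslation_injective
  rw [latticeTranslation_latticeConj]
  exact Subtype.ext (he γ j)

end Automorphisms

/-- A rational right fixed vector gives `det (N - 1) = 0`, which over `ℤ` yields an integral left
fixed vector. The left one is needed because it defines an invariant functional. -/
theorem exists_vecMul_eq_of_ratAut_eq {n : ℕ} (N : GL (Fin n) ℤ) {u : Fin n → ℚ} (hu : u ≠ 0)
    (h : ratAut n N u = u) : ∃ y ≠ 0, Matrix.vecMul y N.val = y := by
  have h1 : ((N.val - 1).map (Int.castRingHom ℚ)).det = 0 := by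
    refine Matrix.exists_mulVec_eq_zero_iff.mp ⟨u, hu, ?_⟩
    rw [Matrix.map_sub _ (map_sub _), Matrix.map_one _ (map_zero _) (map_one _), Matrix.sub_mulVec,
      Matrix.one_mulVec, ← ratAut_apply, h, sub_self]
  have h2 : (N.val - 1).det = 0 := by
    have h3 := RingHom.map_det (Int.castRingHom ℚ) (N.val - 1)
    rw [RingHom.mapMatrix_apply, h1] at h3
    exact (Int.castRingHom ℚ).injective_int (h3.trans (map_zero _).symm)
  obtain ⟨y, hy, hyN⟩ := Matrix.exists_vecMul_eq_zero_iff.mpr h2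
  refine ⟨y, hy, ?_⟩
  rwa [Matrix.vecMul_sub, Matrix.vecMul_one, sub_eq_zero] at hyN

/-! ### Infinite Reidemeister numbers for automorphisms of `Γ` -/

theorem reidemeisterNumber_mulEquiv_eq_top {n : ℕ} {Γ : Subgroup (EucIsom n)}
    (hΓ : DiscreteTopology Γ)
    (ρ : HolonomyGroup Γ →* GL (Fin n) ℤ) (hρ : IsHolonomyRep Γ ρ)
    (hG : Group.IsSolvable (HolonomyGroup Γ)) {n' : ℕ} (ρ' : HolonomyGroup Γ →* GL (Fin n') ℤ)
    (hirr : (ratRep ρ').IsIrreducible) (hsub : IsSubrep (ratRep ρ') (ratRep ρ))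
    (hmult : repMultiplicity (ratRep ρ') (ratRep ρ) = 1) (hodd : Odd n')
    (hsimple : NormalizerRealizesAut ρ') (hnontriv : ρ' ≠ 1) (φ : Γ ≃* Γ) :
    reidemeisterNumber φ.toMonoidHom = ⊤ := by
  obtain ⟨e, he⟩ := hρ
  have hfin := finite_holonomyGroup hΓ e
  have hφ : ∀ ψ : Γ ≃* Γ, ∀ t ∈ translationSubgroup Γ, ψ.toMonoidHom t ∈ translationSubgroup Γ :=
    fun ψ t ht => map_mem_translationSubgroup hΓ e ψ ht
  have hmap : (translationSubgroup Γ).map (φ : Γ →* Γ) = translationSubgroup Γ := by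
    apply le_antisymm
    · rintro _ ⟨t, ht, rfl⟩
      exact hφ φ t ht
    · intro t ht
      exact ⟨φ.symm t, hφ φ.symm t ht, φ.apply_symm_apply t⟩
  let α : MulAut (HolonomyGroup Γ) :=
    QuotientGroup.congr (translationSubgroup Γ) (translationSubgroup Γ) φ hmap
  have hα : ∀ γ : Γ, α (QuotientGroup.mk γ) = QuotientGroup.mk (φ γ) := fun γ => rfl
  let F := latticeMap φ.toMonoidHom (hφ φ)
  have hF : ∀ v, latticeTranslation (F v) = φ (latticeTranslation v) :=
    latticeTranslation_latticeMap _ (hφ φ)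
  let F' := latticeMap φ.symm.toMonoidHom (hφ φ.symm)
  have hF' : ∀ v, latticeTranslation (F' v) = φ.symm (latticeTranslation v) :=
    latticeTranslation_latticeMap _ (hφ φ.symm)
  have hFF' : F ∘ₗ F' = LinearMap.id := by
    refine LinearMap.ext fun v => latticeTranslation_injective ?_
    rw [LinearMap.comp_apply, hF, hF', φ.apply_symm_apply, LinearMap.id_apply]
  have hF'F : F' ∘ₗ F = LinearMap.id := by
    refine LinearMap.ext fun v => latticeTranslation_injective ?_
    rw [LinearMap.comp_apply, hF', hF, φ.symm_apply_apply, LinearMap.id_apply]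
  let M : GL (Fin n) ℤ :=
    { val := LinearMap.toMatrix e e F
      inv := LinearMap.toMatrix e e F'
      val_inv := by rw [← LinearMap.toMatrix_comp, hFF', LinearMap.toMatrix_id]
      inv_val := by rw [← LinearMap.toMatrix_comp, hF'F, LinearMap.toMatrix_id] }
  -- This is `φ (γ t γ⁻¹) = φ γ * φ t * (φ γ)⁻¹` read on the lattice.
  have hM : ∀ g, M * ρ g = ρ (α g) * M := by
    intro g
    obtain ⟨γ, rfl⟩ := QuotientGroup.mk_surjective g
    refine Units.ext ?_
    rw [Units.val_mul, Units.val_mul, hα, ← toMatrix_latticeConj e he, ← toMatrix_latticeConj e he]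
    change LinearMap.toMatrix e e F * _ = _ * LinearMap.toMatrix e e F
    rw [← LinearMap.toMatrix_comp, ← LinearMap.toMatrix_comp]
    congr 1
    refine LinearMap.ext fun v => latticeTranslation_injective ?_
    rw [LinearMap.comp_apply, LinearMap.comp_apply, hF, latticeTranslation_latticeConj,
      latticeTranslation_latticeConj, hF, map_mul, map_mul, map_inv]
  obtain ⟨x, hx⟩ := hsimple.exists_conj α
  obtain ⟨g, u, hu, hgu⟩ := exists_fixed_vector_of_intertwining ρ ρ' hirr hsub hmult hodd hnontriv
    α x hx M hM
  obtain ⟨y, hy, hyN⟩ := exists_vecMul_eq_of_ratAut_eq _ hu hgu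
  obtain ⟨γ₀, rfl⟩ := QuotientGroup.mk_surjective g
  -- The left fixed vector `y` lists the values of `l` on the basis, so `y N = y` says that `l` is
  -- invariant under `φ` followed by conjugation by `γ₀`.
  let l : translationLattice Γ →ₗ[ℤ] ℤ := e.constr ℤ y
  have hl : ∀ v, l (latticeConj γ₀ (F v)) = l v := by
    intro v
    have h : l ∘ₗ (latticeConj γ₀ ∘ₗ F) = l := by
      refine e.ext fun j => ?_
      have hN : LinearMap.toMatrix e e (latticeConj γ₀ ∘ₗ F) =
          (ρ (QuotientGroup.mk γ₀) * M).val := by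
        rw [LinearMap.toMatrix_comp e e e, toMatrix_latticeConj e he]
        rfl
      have h1 : (latticeConj γ₀ ∘ₗ F) (e j) =
          ∑ i, (ρ (QuotientGroup.mk γ₀) * M).val i j • e i := by
        rw [← hN, ← Matrix.toLin_self e e, Matrix.toLin_toMatrix]
      rw [LinearMap.comp_apply, h1, map_sum]
      simp only [map_smul, l, Basis.constr_basis]
      rw [← congrFun hyN j]
      simp [Matrix.vecMul, dotProduct, mul_comm]
    exact LinearMap.congr_fun h v
  let lT : translationSubgroup Γ →* Multiplicative ℤ :=
    (AddMonoidHom.toMultiplicative l.toAddMonoidHom).comp (translationEquiv Γ).toMonoidHom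
  have hlT : ∀ (v : translationLattice Γ) (t : translationSubgroup Γ),
      (t : Γ) = latticeTranslation v → lT t = Multiplicative.ofAdd (l v) := by
    intro v t ht
    have h : (translationEquiv Γ) t = Multiplicative.ofAdd v := by
      rw [← MulEquiv.eq_symm_apply]
      exact Subtype.ext ht
    change AddMonoidHom.toMultiplicative l.toAddMonoidHom (translationEquiv Γ t) = _
    rw [h]
    rfl
  refine reidemeisterNumber_eq_top (translationSubgroup Γ) φ.toMonoidHom γ₀ (hφ φ) lT ?_ ?_
  · intro h1
    obtain ⟨i, hi⟩ := Function.ne_iff.mp hy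
    have h2 := hlT (e i) ⟨latticeTranslation (e i), latticeTranslation_mem _⟩ rfl
    rw [h1] at h2
    have h3 : l (e i) = 0 := (congrArg Multiplicative.toAdd h2).symm
    simp only [l, Basis.constr_basis] at h3
    exact hi h3
  · intro t u htu
    obtain ⟨v, hv⟩ := exists_latticeTranslation_eq t.2
    rw [hlT v t hv.symm, hlT (latticeConj γ₀ (F v)) u, hl]
    rw [htu, latticeTranslation_latticeConj, hF, hv]
    rfl

/-! ### From homeomorphisms to automorphisms of `Γ` -/

theorem fundamentalGroup_map_bijective {X Y : Type*} [TopologicalSpace X] [TopologicalSpace Y]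
    (f : X ≃ₜ Y) (x : X) : Function.Bijective (FundamentalGroup.map (f : C(X, Y)) x) := by
  have h : (FundamentalGroupoid.map (f : C(X, Y))).IsEquivalence :=
    (FundamentalGroupoidFunctor.equivOfHomotopyEquiv f.toHomotopyEquiv).isEquivalence_functor
  exact (CategoryTheory.Functor.FullyFaithful.ofFullyFaithful
    (FundamentalGroupoid.map (f : C(X, Y)))).map_bijective _ _

theorem inducedEnd_bijective {X : Type*} [TopologicalSpace X] (f : X ≃ₜ X) {x : X}
    (p : Path x ((f : C(X, X)) x)) : Function.Bijective (inducedEnd (f : C(X, X)) p) :=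
  (FundamentalGroup.fundamentalGroupMulEquivOfPath p.symm).bijective.comp
    (fundamentalGroup_map_bijective f x)

/-- A flat manifold has the property `R_∞` as soon as all automorphisms of its fundamental group
have infinite Reidemeister number. -/
theorem hasRInfinity_flatOrbitSpace {n : ℕ} {Γ : Subgroup (EucIsom n)} (hΓ : IsBieberbach Γ)
    [Finite (HolonomyGroup Γ)]
    (h : ∀ φ : Γ ≃* Γ, reidemeisterNumber φ.toMonoidHom = ⊤) : HasRInfinity (FlatOrbitSpace Γ) := by
  intro f x p
  have hcov := isQuotientCoveringMap_flatOrbitSpace hΓ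
  obtain ⟨y, hy⟩ := Quotient.exists_rep x
  -- The covering identifies the fundamental group with the opposite group of `Γ`; inversion turns
  -- this into an isomorphism with `Γ`.
  let E : FundamentalGroup (FlatOrbitSpace Γ) x ≃* Γ :=
    (hcov.fundamentalGroupEquiv ⟨y, hy⟩).trans (MulEquiv.inv' Γ).symm
  let ψ := MulEquiv.ofBijective _ (inducedEnd_bijective f p)
  rw [← h ((E.symm.trans ψ).trans E)]
  refine reidemeisterNumber_congr E _ _ fun g => ?_
  simp [ψ]

theorem mainTheorem3 {n : ℕ} (Γ : Subgroup (EucIsom n)) (hΓ : IsBieberbach Γ)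
    (ρ : HolonomyGroup Γ →* GL (Fin n) ℤ) (hρ : IsHolonomyRep Γ ρ)
    (hG : Group.IsSolvable (HolonomyGroup Γ))
    {n' : ℕ} (ρ' : HolonomyGroup Γ →* GL (Fin n') ℤ)
    (hirr : (ratRep ρ').IsIrreducible)
    (hsub : IsSubrep (ratRep ρ') (ratRep ρ))
    (hmult : repMultiplicity (ratRep ρ') (ratRep ρ) = 1)
    (hodd : Odd n')
    (hsimple : NormalizerRealizesAut ρ')
    (hnontriv : ρ' ≠ 1) :
    HasRInfinity (FlatOrbitSpace Γ) := by
  have : Finite (HolonomyGroup Γ) := by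
    obtain ⟨e, -⟩ := hρ
    exact finite_holonomyGroup hΓ.discrete e
  exact hasRInfinity_flatOrbitSpace hΓ fun φ => reidemeisterNumber_mulEquiv_eq_top hΓ.discrete ρ hρ
    hG ρ' hirr hsub hmult hodd hsimple hnontriv φ

end
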